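/- Let $p$ be an odd prime. For a partition $\lambda$ of $n$ let $[\lambda]$ denote the character of the Specht module $S^\lambda$ of the symmetric group $\mathfrak S_n$ in characteristic $0$. The residue of a node $(x,y)$ (row $x$, column $y$) is the residue of $y-x$ modulo $p$, and the content of a partition is the multiset of residues of its nodes; the $p$-blocks of $\mathfrak S_n$ are labelled by the contents of partitions of $n$, the ordinary irreducible characters in the block with content $C$ being the $[\lambda]$ for which $\lambda$ has content $C$. For $\varepsilon\in\mathbb Z/p\mathbb Z$ and a generalised character $\chi$ of $\mathfrak S_n$ in the block with content $C$, let $e_\varepsilon\chi$ be the component of the restriction $\chi{\downarrow}_{\mathfrak S_{n-1}}$ in the block with content $C\setminus\{\varepsilon\}$, and $f_\varepsilon\chi$ the component of the induced character $\chi{\uparrow}^{\mathfrak S_{n+1}}$ in the block with content $C\sqcup\{\varepsilon\}$ (zero if there is no such block); extend both linearly. Put $e_\varepsilon^{(k)}=e_\varepsilon^k/k!$, $f_\varepsilon^{(k)}=f_\varepsilon^k/k!$ and, for $c\in\mathbb Z$, \[ S_\varepsilon^{(c)}=\sum_{k\ge\max\{0,-c\}}(-1)^{k+c}f_\varepsilon^{(k+c)}e_\varepsilon^{(k)}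 . \] The $r$-bead abacus display of a partition $\lambda$ with at most $r$ non-zero parts has beads at the positions $\lambda_j+r-j$ for $1\le j\le r$; runner $j$ consists of the positions $j,j+p,j+2p,\dots$. (The $p$ runners are runners $0,\dots,p-1$; runner $p$ stands for runner $0$ without its top position.) Swapping runners $i-1$ and $i$ means interchanging the contents of the positions $i-1+kp$ and $i+kp$ for all $k\ge0$. Let $\lambda$ be a partition, $i\in\{1,\dots,p\}$, and suppose that an $r$-bead abacus display for $\lambda$ has $a$ more beads on runner $i-1$ than on runner $i$, where $a\in\mathbb Z$; if $i=p$, suppose also that $r$ is greater than the number of non-zero parts of $\lambda$. Let $\varepsilon$ be the residue of $i-r$ modulo $p$. Then swapping runners $i-1$ and $i$ gives the $r$-bead abacus display of a unique partition $\mu$, and \[ S_\varepsilon^{(a)}[\lambda]=\pm[\mu],\qquad S_\varepsilon^{(-a)}[\mu]=\pm[\lambda]. \] -/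

import Mathlib

noncomputable section

namespace RunnerSwap

/-! ### Specht modules and their characters

A partition is a `YoungDiagram`; its cells `(i, j)` (row `i`, column `j`) are counted from `0`. -/

/-- A tableau of shape `la` with entries `Fin n`, each used once (none exists unless `n = |la|`). -/
abbrev Tableau (la : YoungDiagram) (n : ℕ) : Type := {x : ℕ × ℕ // x ∈ la.cells} ≃ Fin n

/-- The permutation representation of `S_n` on the rational vector space spanned by all functions
`Fin n → ℕ`. A tabloid is such a function: it sends every entry to the row it lies in. -/
def tabloidRep (n : ℕ) :
    Representation ℚ (Equiv.Perm (Fin n)) ((Fin n → ℕ) →₀ ℚ) where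
  toFun g := Finsupp.lmapDomain ℚ ℚ (fun t : Fin n → ℕ => fun x => t (g⁻¹ x))
  map_one' := by
    refine Finsupp.lhom_ext fun t c => ?_
    simp
  map_mul' g h := by
    refine Finsupp.lhom_ext fun t c => ?_
    simp [Finsupp.mapDomain_single]

/-- The tabloid of a tableau: the row of every entry. -/
def Tableau.tabloid {la : YoungDiagram} {n : ℕ} (T : Tableau la n) : Fin n → ℕ :=
  fun x => (T.symm x).1.1

/-- The column stabiliser of a tableau. -/
def Tableau.colStab {la : YoungDiagram} {n : ℕ} (T : Tableau la n) :
    Finset (Equiv.Perm (Fin n)) :=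
  Finset.univ.filter (fun g => ∀ x, (T.symm (g x)).1.2 = (T.symm x).1.2)

/-- The polytabloid `∑ sgn(g) g{T}`, summed over the column stabiliser of `T`. -/
def Tableau.polytabloid {la : YoungDiagram} {n : ℕ} (T : Tableau la n) : (Fin n → ℕ) →₀ ℚ :=
  ∑ g ∈ T.colStab, ((Equiv.Perm.sign g : ℤ) : ℚ) • tabloidRep n g (Finsupp.single T.tabloid 1)

theorem tabloidRep_polytabloid {la : YoungDiagram} {n : ℕ} (h : Equiv.Perm (Fin n))
    (T : Tableau la n) :
    tabloidRep n h T.polytabloid = Tableau.polytabloid (T.trans h : Tableau la n) := by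
  unfold Tableau.polytabloid
  rw [map_sum]
  refine Finset.sum_bij' (fun g _ => h * g * h⁻¹) (fun g _ => h⁻¹ * g * h) ?_ ?_ ?_ ?_ ?_
  · intro g hg
    simp only [Tableau.colStab, Finset.mem_filter, Finset.mem_univ, true_and] at hg ⊢
    intro x
    simpa using hg (h⁻¹ x)
  · intro g hg
    simp only [Tableau.colStab, Finset.mem_filter, Finset.mem_univ, true_and] at hg ⊢
    intro x
    simpa using hg (h x)
  · intro g _; group
  · intro g _; group
  · intro g _
    have hT : Finsupp.single (Tableau.tabloid (T.trans h : Tableau la n)) (1 : ℚ)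
        = tabloidRep n h (Finsupp.single T.tabloid 1) := by
      simp only [tabloidRep, MonoidHom.coe_mk, OneHom.coe_mk, Finsupp.lmapDomain_apply,
        Finsupp.mapDomain_single]
      rfl
    rw [hT, map_smul, ← Module.End.mul_apply, ← Module.End.mul_apply, ← map_mul, ← map_mul]
    have hs : ((Equiv.Perm.sign (h * g * h⁻¹) : ℤ) : ℚ) = ((Equiv.Perm.sign g : ℤ) : ℚ) := by
      rw [map_mul, map_mul, mul_right_comm, ← map_mul, mul_inv_cancel, map_one, one_mul]
    rw [hs]
    simp

/-- The Specht module of shape `la`, spanned by the polytabloids, as a representation of `S_n`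
(it is zero unless `n = |la|`). -/
def specht (la : YoungDiagram) (n : ℕ) : Subrepresentation (tabloidRep n) where
  toSubmodule := Submodule.span ℚ (Set.range (fun T : Tableau la n => T.polytabloid))
  apply_mem_toSubmodule g v hv := by
    induction hv using Submodule.span_induction with
    | mem x hx =>
      obtain ⟨T, rfl⟩ := hx
      rw [tabloidRep_polytabloid]
      exact Submodule.subset_span ⟨T.trans g, rfl⟩
    | zero => simp
    | add x y _ _ hx hy => rw [map_add]; exact Submodule.add_mem _ hx hy
    | smul c x _ hx => rw [map_smul]; exact Submodule.smul_mem _ c hx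

/-- Families of rational functions on all the symmetric groups `S_0, S_1, S_2, …`; generalised
characters (of one symmetric group, or sums of such over several of them) are elements. -/
abbrev ClassFun : Type := (n : ℕ) → Equiv.Perm (Fin n) → ℚ

/-- The character `[la]` of the Specht module, in degree `|la|`; it is zero in other degrees. -/
def spechtChar (la : YoungDiagram) : ClassFun :=
  fun n => (specht la n).toRepresentation.character

/-! ### Restriction, induction and their block components -/

/-- `S_n` inside `S_{n+1}` as the permutations that fix the last point. -/
def incl (n : ℕ) : Equiv.Perm (Fin n) →* Equiv.Perm (Fin (n + 1)) :=
  Equiv.Perm.viaEmbeddingHom (Fin.castSuccEmb : Fin n ↪ Fin (n + 1))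

/-- Restriction of class functions from `S_{n+1}` to `S_n`. -/
def res (n : ℕ) : (Equiv.Perm (Fin (n + 1)) → ℚ) →ₗ[ℚ] (Equiv.Perm (Fin n) → ℚ) :=
  LinearMap.funLeft ℚ ℚ (incl n)

/-- Induction of class functions from `S_n` to `S_{n+1}`:
`(ind χ)(g) = |S_n|⁻¹ ∑ χ(x g x⁻¹)`, summed over the `x ∈ S_{n+1}` with `x g x⁻¹ ∈ S_n`. -/
def ind (n : ℕ) : (Equiv.Perm (Fin n) → ℚ) →ₗ[ℚ] (Equiv.Perm (Fin (n + 1)) → ℚ) where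
  toFun χ g := (n.factorial : ℚ)⁻¹ *
    ∑ x : Equiv.Perm (Fin (n + 1)), ∑ k : Equiv.Perm (Fin n),
      if incl n k = x * g * x⁻¹ then χ k else 0
  map_add' χ ψ := by
    funext g
    simp only [Pi.add_apply, ← mul_add, ← Finset.sum_add_distrib]
    congr 1
    refine Finset.sum_congr rfl fun x _ => Finset.sum_congr rfl fun k _ => ?_
    split_ifs <;> simp
  map_smul' c χ := by
    funext g
    simp only [Pi.smul_apply, smul_eq_mul, RingHom.id_apply, Finset.mul_sum]
    refine Finset.sum_congr rfl fun x _ => Finset.sum_congr rfl fun k _ => ?_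
    split_ifs <;> ring

/-- The inner product of class functions, as a linear function of the first one. -/
def inner (n : ℕ) (ψ : Equiv.Perm (Fin n) → ℚ) : (Equiv.Perm (Fin n) → ℚ) →ₗ[ℚ] ℚ :=
  (n.factorial : ℚ)⁻¹ • ∑ g : Equiv.Perm (Fin n), ψ g⁻¹ • LinearMap.proj g

theorem finite_partitions (n : ℕ) : {la : YoungDiagram | la.card = n}.Finite := by
  have hinj : Function.Injective YoungDiagram.cells := fun a b h => YoungDiagram.ext h
  refine Set.Finite.of_finite_image (f := YoungDiagram.cells) ?_ hinj.injOn
  refine ((Finset.range n ×ˢ Finset.range n).powerset.finite_toSet).subset ?_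
  rintro _ ⟨la, hla, rfl⟩
  simp only [Finset.coe_powerset, Set.mem_preimage, Set.mem_powerset_iff, Finset.coe_subset]
  rintro ⟨i, j⟩ hij
  have hla' : la.cells.card = n := hla
  have h1 : la.rowLen i ≤ n := by
    rw [YoungDiagram.rowLen_eq_card, ← hla']
    exact Finset.card_le_card (Finset.filter_subset _ _)
  have h2 : la.colLen j ≤ n := by
    rw [YoungDiagram.colLen_eq_card, ← hla']
    exact Finset.card_le_card (Finset.filter_subset _ _)
  have h3 := YoungDiagram.mem_iff_lt_rowLen.1 (YoungDiagram.mem_cells _ |>.1 hij)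
  have h4 := YoungDiagram.mem_iff_lt_colLen.1 (YoungDiagram.mem_cells _ |>.1 hij)
  simp only [Finset.mem_product, Finset.mem_range]
  omega

/-- The partitions of `n`. -/
def partitions (n : ℕ) : Finset YoungDiagram := (finite_partitions n).toFinset

/-- The content of a partition: the multiset of the residues `column - row` modulo `p` of its
nodes. -/
def content (p : ℕ) (la : YoungDiagram) : Multiset (ZMod p) :=
  la.cells.val.map (fun x => (x.2 : ZMod p) - (x.1 : ZMod p))

/-- The contents of the partitions of `n`, which index the `p`-blocks of `S_n`. -/
def contents (p n : ℕ) : Finset (Multiset (ZMod p)) := by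
  classical exact (partitions n).image (content p)

open Classical in
/-- The component of a class function of `S_n` in the `p`-block with content `C`. The ordinary
irreducible characters in this block are the `[la]` for the partitions `la` of `n` with content
`C`; if there is no such `la`, then there is no such block and the component is `0`. -/
def blockComponent (p n : ℕ) (C : Multiset (ZMod p)) :
    (Equiv.Perm (Fin n) → ℚ) →ₗ[ℚ] (Equiv.Perm (Fin n) → ℚ) :=
  ∑ la ∈ (partitions n).filter (fun la => content p la = C),
    (inner n (spechtChar la n)).smulRight (spechtChar la n)

/-- The restriction functor `e_ε`: a class function in the block with content `C + {ε}` of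
`S_{n+1}` is sent to the component of its restriction to `S_n` in the block with content `C`. -/
def eFun (p : ℕ) (ε : ZMod p) : Module.End ℚ ClassFun :=
  LinearMap.pi fun n =>
    (∑ C ∈ contents p n,
      blockComponent p n C ∘ₗ res n ∘ₗ blockComponent p (n + 1) (ε ::ₘ C)) ∘ₗ
      LinearMap.proj (n + 1)

/-- The induction functor `f_ε`: a class function in the block with content `C` of `S_n` is sent
to the component of the induced function on `S_{n+1}` in the block with content `C + {ε}`. -/
def fFun (p : ℕ) (ε : ZMod p) : Module.End ℚ ClassFun :=
  LinearMap.pi fun m =>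
    match m with
    | 0 => 0
    | n + 1 =>
      (∑ C ∈ contents p n,
        blockComponent p (n + 1) (ε ::ₘ C) ∘ₗ ind n ∘ₗ blockComponent p n C) ∘ₗ
        LinearMap.proj n

/-- Divided powers. -/
def divPow (T : Module.End ℚ ClassFun) (k : ℕ) : Module.End ℚ ClassFun :=
  (k.factorial : ℚ)⁻¹ • T ^ k

/-- The runner-swapping function
`S_ε^{(c)} = ∑_{a ≥ max(0, -c)} (-1)^{a+c} f_ε^{(a+c)} e_ε^{(a)}`. The sum is taken degree by
degree; in degree `n` only the terms with `a + c ≤ n` can be nonzero. -/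
def runnerSwap (p : ℕ) (ε : ZMod p) (c : ℤ) (χ : ClassFun) : ClassFun :=
  fun n => ∑ᶠ (a : ℕ) (_ : -c ≤ (a : ℤ)),
    (-1 : ℚ) ^ (a + c).toNat •
      divPow (fFun p ε) (a + c).toNat (divPow (eFun p ε) a χ) n

/-! ### Abacus displays -/

/-- `B` is the set of positions of the beads in the `r`-bead abacus display of `la`: one has
`r ≥ ℓ(la)`, and the beads are at the beta-numbers `la_i + r - i` for `1 ≤ i ≤ r` (rows are
counted from `0` here). -/
def IsAbacusDisplay (la : YoungDiagram) (r : ℕ) (B : Finset ℕ) : Prop :=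
  la.colLen 0 ≤ r ∧ B = (Finset.range r).image (fun i => la.rowLen i + (r - 1 - i))

/-- Position `x` lies on runner `j` of the `p`-runner abacus, that is, `x` is one of `j`, `j + p`,
`j + 2p`, …. The runners are numbered `0, …, p - 1`; runner `p` stands for runner `0` without its
top position, moved up by one row. -/
def OnRunner (p j x : ℕ) : Prop := ∃ k : ℕ, x = j + k * p

open Classical in
/-- The number of beads on runner `j`. -/
def beadCount (p : ℕ) (B : Finset ℕ) (j : ℕ) : ℕ := (B.filter (OnRunner p j)).card

open Classical in
/-- The bead positions after swapping runners `i - 1` and `i`. -/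
def swapRunners (p i : ℕ) (B : Finset ℕ) : Finset ℕ :=
  B.image (fun x => if OnRunner p (i - 1) x then x + 1 else if OnRunner p i x then x - 1 else x)

end RunnerSwap

end

noncomputable section

namespace RunnerSwap

/-! ### Column antisymmetrisers -/

section Tableaux

variable {la mu : YoungDiagram} {n : ℕ}

/-! A runner swap is complementation in a Boolean lattice. Let `U` be the set of abacus rows `k` in
which exactly one of the adjacent positions `i - 1 + k p`, `i + k p` holds a bead. For `X ⊆ U` let
that bead lie on runner `i` if `k ∈ X` and on runner `i - 1` otherwise, all other beads being fixed.
Adding or removing a node of residue `ε` moves one bead between these runners. By the branching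
rule, `e_ε` therefore sends `X` to the sum of the `X \ {k}`, and `f_ε` sends it to the sum of the `X
∪ {k}` (`eFun_beadFamily`, `fFun_beadFamily`).

Divided powers cancel the orderings of the moves, so `f^(b) e^(a) X` is the sum over `X ⊇ Y ⊆ Z`
with `|X \ Y| = a` and `|Z \ Y| = b`. In `S_ε^(c) X` with `c = |U \ X| - |X|`, the coefficient of `Z
= U \ W` is up to sign the sum of `(-1)^|Y|` over `Y ⊆ X \ W`. It vanishes unless `X ⊆ W`, and since
`|W| = |X|` only `Z = U \ X` survives (`runnerSwap_boolean`). The two partitions are complementary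
subsets with `a = |U \ X| - |X|`.

The branching rule (`mult_eq_contains`) is derived from the definition of Specht modules. Column
antisymmetrisers make the Specht characters orthonormal, with the sum of row indices in place of the
dominance order. Deleting the last entry shows that `[la]` occurs in the restriction of `[mu]`
whenever `mu` is `la` plus a cell. The upper bound is a count: the path numbers of Young's lattice
have squares summing to `n!`, they bound the degrees from below, and Bessel's inequality for the
regular character bounds the sum of squared degrees by `n!`. All inequalities are then equalities.
Frobenius reciprocity handles induction. -/

theorem tabloidRep_single (g : Equiv.Perm (Fin n)) (t : Fin n → ℕ) (c : ℚ) :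
    tabloidRep n g (Finsupp.single t c) = Finsupp.single (fun x => t (g⁻¹ x)) c := by
  simp [tabloidRep, Finsupp.mapDomain_single]

theorem tabloidRep_mul_apply (g h : Equiv.Perm (Fin n)) (v : (Fin n → ℕ) →₀ ℚ) :
    tabloidRep n (g * h) v = tabloidRep n g (tabloidRep n h v) := by
  rw [map_mul, Module.End.mul_apply]

theorem tabloidRep_apply (g : Equiv.Perm (Fin n)) (v : (Fin n → ℕ) →₀ ℚ) (t : Fin n → ℕ) :
    tabloidRep n g v t = v (fun x => t (g x)) := by
  induction v using Finsupp.induction_linear with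
  | zero => simp
  | add v w hv hw => rw [map_add, Finsupp.add_apply, hv, hw, Finsupp.add_apply]
  | single s c =>
    rw [tabloidRep_single, Finsupp.single_apply, Finsupp.single_apply]
    refine if_congr ⟨?_, ?_⟩ rfl rfl
    · rintro rfl; simp
    · rintro rfl; simp

theorem Tableau.mem_colStab {T : Tableau la n} {g : Equiv.Perm (Fin n)} :
    g ∈ T.colStab ↔ ∀ x, (T.symm (g x)).1.2 = (T.symm x).1.2 := by
  simp [Tableau.colStab]

theorem Tableau.one_mem_colStab (T : Tableau la n) : 1 ∈ T.colStab := by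
  simp [Tableau.mem_colStab]

theorem Tableau.mul_mem_colStab {T : Tableau la n} {g h : Equiv.Perm (Fin n)}
    (hg : g ∈ T.colStab) (hh : h ∈ T.colStab) : g * h ∈ T.colStab := by
  rw [Tableau.mem_colStab] at *
  intro x
  rw [Equiv.Perm.mul_apply, hg, hh]

theorem Tableau.inv_mem_colStab {T : Tableau la n} {g : Equiv.Perm (Fin n)}
    (hg : g ∈ T.colStab) : g⁻¹ ∈ T.colStab := by
  rw [Tableau.mem_colStab] at *
  intro x
  simpa using (hg (g⁻¹ x)).symm

/-- Two entries in the same row and in the same column of a tableau agree. -/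
theorem Tableau.eq_of_row_of_col (T : Tableau la n) {x y : Fin n} (h1 : T.tabloid x = T.tabloid y)
    (h2 : (T.symm x).1.2 = (T.symm y).1.2) : x = y :=
  T.symm.injective (Subtype.ext (Prod.ext h1 h2))

/-- The signed column sum of a tableau. -/
def Tableau.colOp (T : Tableau la n) : Module.End ℚ ((Fin n → ℕ) →₀ ℚ) :=
  ∑ g ∈ T.colStab, ((Equiv.Perm.sign g : ℤ) : ℚ) • tabloidRep n g

theorem Tableau.colOp_apply (T : Tableau la n) (v : (Fin n → ℕ) →₀ ℚ) :
    T.colOp v = ∑ g ∈ T.colStab, ((Equiv.Perm.sign g : ℤ) : ℚ) • tabloidRep n g v := by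
  simp [Tableau.colOp]

theorem Tableau.colOp_tabloid (T : Tableau la n) :
    T.colOp (Finsupp.single T.tabloid 1) = T.polytabloid :=
  T.colOp_apply _

/-- Reindexing the sum by right multiplication by `h` costs the factor `sgn h`. -/
theorem Tableau.colOp_tabloidRep {T : Tableau la n} {h : Equiv.Perm (Fin n)} (hh : h ∈ T.colStab)
    (v : (Fin n → ℕ) →₀ ℚ) :
    T.colOp (tabloidRep n h v) = ((Equiv.Perm.sign h : ℤ) : ℚ) • T.colOp v := by
  rw [T.colOp_apply, T.colOp_apply, Finset.smul_sum]
  refine Finset.sum_bij' (fun g _ => g * h) (fun g _ => g * h⁻¹)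
    (fun g hg => mul_mem_colStab hg hh) (fun g hg => mul_mem_colStab hg (inv_mem_colStab hh))
    (by simp) (by simp) fun g _ => ?_
  rw [← tabloidRep_mul_apply, smul_smul, ← Int.cast_mul, ← Units.val_mul, ← map_mul]
  congr 3
  rw [map_mul, map_mul, mul_comm, mul_assoc, Int.units_mul_self, mul_one]

theorem Tableau.colOp_polytabloid (T : Tableau la n) :
    T.colOp T.polytabloid = (T.colStab.card : ℚ) • T.polytabloid := by
  conv_lhs => rw [Tableau.polytabloid]
  rw [map_sum, Finset.sum_congr rfl (g := fun _ => T.polytabloid), Finset.sum_const,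
    Nat.cast_smul_eq_nsmul]
  intro g hg
  rw [map_smul, colOp_tabloidRep hg, smul_smul, ← Int.cast_mul, ← Units.val_mul,
    Int.units_mul_self, colOp_tabloid]
  simp

theorem Tableau.colStab_card_ne_zero (T : Tableau la n) : (T.colStab.card : ℚ) ≠ 0 := by
  simpa using Finset.ne_empty_of_mem T.one_mem_colStab

/-- The transposition of `x` and `y` is an odd column permutation that fixes `t`, so the image
equals its own negative. -/
theorem Tableau.colOp_single_eq_zero (T : Tableau la n) {t : Fin n → ℕ} {x y : Fin n}
    (hxy : x ≠ y) (hcol : (T.symm x).1.2 = (T.symm y).1.2) (ht : t x = t y) :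
    T.colOp (Finsupp.single t 1) = 0 := by
  have hs : Equiv.swap x y ∈ T.colStab := by
    rw [mem_colStab]
    intro z
    by_cases h1 : z = x
    · subst h1; simp [hcol]
    · by_cases h2 : z = y
      · subst h2; simp [hcol]
      · rw [Equiv.swap_apply_of_ne_of_ne h1 h2]
  have h1 := colOp_tabloidRep hs (Finsupp.single t 1)
  have h2 : tabloidRep n (Equiv.swap x y) (Finsupp.single t 1) = Finsupp.single t 1 := by
    rw [tabloidRep_single]
    congr 1
    funext z
    by_cases h1 : z = x
    · subst h1; simp [ht]
    · by_cases h2 : z = y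
      · subst h2; simp [ht]
      · rw [Equiv.swap_inv, Equiv.swap_apply_of_ne_of_ne h1 h2]
  rw [h2, Equiv.Perm.sign_swap hxy] at h1
  have h3 : (2 : ℚ) • T.colOp (Finsupp.single t 1) = 0 := by
    rw [two_smul]
    nth_rewrite 1 [h1]
    simp
  simpa using h3

/-- A column permutation fixing the tabloid preserves the row and the column of every entry, so only
the identity contributes. -/
theorem Tableau.polytabloid_apply_tabloid (T : Tableau la n) : T.polytabloid T.tabloid = 1 := by
  rw [Tableau.polytabloid, Finsupp.finsetSum_apply, Finset.sum_eq_single 1]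
  · simp
  · intro g hg hg1
    rw [Finsupp.smul_apply, tabloidRep_single, Finsupp.single_apply, if_neg, smul_zero]
    intro h
    refine hg1 (inv_injective (Equiv.ext fun x => T.eq_of_row_of_col ?_ ?_))
    · simpa using congrFun h x
    · simpa using mem_colStab.1 (inv_mem_colStab hg) x
  · intro h
    exact absurd T.one_mem_colStab h

theorem Tableau.polytabloid_ne_zero (T : Tableau la n) : T.polytabloid ≠ 0 := by
  intro h
  have := T.polytabloid_apply_tabloid
  simp [h] at this

/-! ### Column-injective fillings -/

/-- Induction by deleting the maximum, which for `k + 1` distinct naturals is at least `k`. -/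
theorem sum_range_card_le (s : Finset ℕ) :
    ∑ i ∈ Finset.range s.card, i ≤ ∑ i ∈ s, i ∧
      (∑ i ∈ s, i = ∑ i ∈ Finset.range s.card, i → s = Finset.range s.card) := by
  induction h : s.card generalizing s with
  | zero => simp_all
  | succ k ih =>
    have hne : s.Nonempty := Finset.card_pos.1 (by omega)
    set M := s.max' hne
    have hM : M ∈ s := s.max'_mem hne
    have hc : (s.erase M).card = k := by rw [Finset.card_erase_of_mem hM]; omega
    obtain ⟨h1, h2⟩ := ih _ hc
    have hk : k ≤ M := by
      have : s ⊆ Finset.range (M + 1) := fun x hx => by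
        have := s.le_max' x hx
        simp only [Finset.mem_range]; omega
      have := Finset.card_le_card this
      simp at this; omega
    have hs := Finset.add_sum_erase s (fun i => i) hM
    rw [Finset.sum_range_succ]
    refine ⟨by omega, fun he => ?_⟩
    have hMk : M = k := by omega
    have := h2 (by omega)
    rw [← Finset.insert_erase hM, this, hMk, Finset.range_add_one]

/-- The sum of the row indices of the cells. -/
def rowSum (la : YoungDiagram) : ℕ := ∑ c ∈ la.cells, c.1

theorem Tableau.sum_tabloid (T : Tableau la n) : ∑ x, T.tabloid x = rowSum la := by
  rw [rowSum, ← Finset.sum_attach la.cells (fun c => c.1), ← Finset.univ_eq_attach]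
  exact Fintype.sum_equiv T.symm _ _ fun _ => rfl

/-- The entries in a column of a tableau. -/
def Tableau.column (T : Tableau la n) (c : ℕ) : Finset (Fin n) :=
  Finset.univ.filter fun x => (T.symm x).1.2 = c

theorem Tableau.mem_column {T : Tableau la n} {c : ℕ} {x : Fin n} :
    x ∈ T.column c ↔ (T.symm x).1.2 = c := by
  simp [Tableau.column]

theorem Tableau.injOn_column {T : Tableau la n} {t : Fin n → ℕ}
    (ht : ∀ x y, (T.symm x).1.2 = (T.symm y).1.2 → t x = t y → x = y) (c : ℕ) :
    Set.InjOn t (T.column c) := by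
  intro x hx y hy h
  rw [Finset.mem_coe, mem_column] at hx hy
  exact ht x y (hx.trans hy.symm) h

theorem Tableau.image_tabloid_column (T : Tableau la n) (c : ℕ) :
    (T.column c).image T.tabloid = Finset.range (T.column c).card := by
  have h : (T.column c).image T.tabloid = Finset.range (la.colLen c) := by
    ext i
    simp only [Finset.mem_image, Finset.mem_range, mem_column, ← YoungDiagram.mem_iff_lt_colLen]
    constructor
    · rintro ⟨x, hx, rfl⟩
      have := (T.symm x).2
      rw [YoungDiagram.mem_cells] at this
      rw [← hx]
      exact this
    · intro hi
      exact ⟨T ⟨(i, c), hi⟩, by simp, by simp [Tableau.tabloid]⟩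
  have hc : (T.column c).card = la.colLen c := by
    rw [← Finset.card_image_of_injOn
      (T.injOn_column (t := T.tabloid) (fun x y h1 h2 => T.eq_of_row_of_col h2 h1) c), h,
      Finset.card_range]
  rw [h, hc]

theorem Tableau.sum_column (T : Tableau la n) (t : Fin n → ℕ) :
    ∑ x, t x = ∑ c ∈ Finset.univ.image (fun x => (T.symm x).1.2), ∑ x ∈ T.column c, t x :=
  (Finset.sum_fiberwise_of_maps_to (fun x _ => Finset.mem_image_of_mem _ (Finset.mem_univ x)) _).symm

theorem Tableau.sum_column_le (T : Tableau la n) {t : Fin n → ℕ}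
    (ht : ∀ x y, (T.symm x).1.2 = (T.symm y).1.2 → t x = t y → x = y) (c : ℕ) :
    ∑ x ∈ T.column c, T.tabloid x ≤ ∑ x ∈ T.column c, t x ∧
      (∑ x ∈ T.column c, t x = ∑ x ∈ T.column c, T.tabloid x →
        (T.column c).image t = (T.column c).image T.tabloid) := by
  have h0 := T.injOn_column (t := T.tabloid) (fun x y h1 h2 => T.eq_of_row_of_col h2 h1) c
  have h1 := T.injOn_column ht c
  have e0 := Finset.sum_image (f := fun i => i) h0
  have e1 := Finset.sum_image (f := fun i => i) h1
  rw [← e0, ← e1, T.image_tabloid_column, ← Finset.card_image_of_injOn h1]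
  exact sum_range_card_le _

/-- A filling that is injective on the columns of `T` has at least the weight of `T`, with
equality only for the column permutations of the tabloid of `T`. -/
theorem Tableau.rowSum_le (T : Tableau la n) {t : Fin n → ℕ}
    (ht : ∀ x y, (T.symm x).1.2 = (T.symm y).1.2 → t x = t y → x = y) :
    rowSum la ≤ ∑ x, t x ∧
      (∑ x, t x = rowSum la → ∃ h ∈ T.colStab, t = fun x => T.tabloid (h x)) := by
  rw [← T.sum_tabloid, T.sum_column, T.sum_column t]
  have hle := fun c (_ : c ∈ Finset.univ.image (fun x => (T.symm x).1.2)) =>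
    (T.sum_column_le ht c).1
  refine ⟨Finset.sum_le_sum hle, fun he => ?_⟩
  have heq := (Finset.sum_eq_sum_iff_of_le hle).1 he.symm
  -- Equality of the totals forces equality in each column, where `t` then takes the same values as
  -- the tabloid. Matching values yields the column permutation.
  have hex : ∀ x, ∃ y, (T.symm y).1.2 = (T.symm x).1.2 ∧ T.tabloid y = t x := by
    intro x
    have h1 := (T.sum_column_le ht _).2
      (heq _ (Finset.mem_image_of_mem _ (Finset.mem_univ x))).symm
    have h2 : t x ∈ (T.column (T.symm x).1.2).image t :=
      Finset.mem_image_of_mem _ (mem_column.2 rfl)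
    rw [h1, Finset.mem_image] at h2
    obtain ⟨y, hy, hy'⟩ := h2
    exact ⟨y, mem_column.1 hy, hy'⟩
  choose h hcol hrow using hex
  have hinj : Function.Injective h := fun x y hxy =>
    ht x y (by rw [← hcol x, ← hcol y, hxy]) (by rw [← hrow x, ← hrow y, hxy])
  refine ⟨Equiv.ofBijective h (Finite.injective_iff_bijective.1 hinj), ?_, ?_⟩
  · exact mem_colStab.2 fun x => hcol x
  · funext x
    exact (hrow x).symm

theorem Tableau.card_tabloid_eq (T : Tableau la n) (i : ℕ) :
    (Finset.univ.filter fun x => T.tabloid x = i).card = la.rowLen i := by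
  rw [YoungDiagram.rowLen_eq_card]
  refine Finset.card_bij (fun x _ => (T.symm x).1) ?_ ?_ ?_
  · intro x hx
    rw [YoungDiagram.mem_row_iff]
    exact ⟨(T.symm x).2, (Finset.mem_filter.1 hx).2⟩
  · intro x _ y _ h
    exact T.symm.injective (Subtype.ext h)
  · intro c hc
    rw [YoungDiagram.mem_row_iff] at hc
    refine ⟨T ⟨c, hc.1⟩, Finset.mem_filter.2 ⟨Finset.mem_univ _, ?_⟩, by simp⟩
    rw [Tableau.tabloid, Equiv.symm_apply_apply]
    exact hc.2

theorem eq_of_rowLen_eq (h : ∀ i, la.rowLen i = mu.rowLen i) : la = mu := by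
  refine SetLike.ext fun c => ?_
  obtain ⟨i, j⟩ := c
  rw [YoungDiagram.mem_iff_lt_rowLen, YoungDiagram.mem_iff_lt_rowLen, h]

theorem Tableau.shape_eq (T : Tableau la n) (T' : Tableau mu n) (h : Equiv.Perm (Fin n))
    (ht : T'.tabloid = fun x => T.tabloid (h x)) : la = mu := by
  refine eq_of_rowLen_eq fun i => ?_
  rw [← T.card_tabloid_eq, ← T'.card_tabloid_eq]
  refine (Finset.card_equiv h fun x => ?_).symm
  simp [ht]

/-! ### The span of the tabloids of a given shape -/

/-- The span of the tabloids of shape `mu`. -/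
def tabloidSpan (mu : YoungDiagram) (n : ℕ) : Submodule ℚ ((Fin n → ℕ) →₀ ℚ) :=
  Submodule.span ℚ (Set.range fun T : Tableau mu n => Finsupp.single T.tabloid 1)

theorem tabloidRep_tabloid (h : Equiv.Perm (Fin n)) (T : Tableau la n) :
    tabloidRep n h (Finsupp.single T.tabloid 1) =
      Finsupp.single (Tableau.tabloid (T.trans h : Tableau la n)) (1 : ℚ) := by
  rw [tabloidRep_single]
  rfl

theorem specht_le_tabloidSpan : (specht mu n).toSubmodule ≤ tabloidSpan mu n := by
  refine Submodule.span_le.2 ?_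
  rintro _ ⟨T, rfl⟩
  refine Submodule.sum_mem _ fun g _ => Submodule.smul_mem _ _ ?_
  rw [tabloidRep_tabloid]
  exact Submodule.subset_span ⟨_, rfl⟩

theorem polytabloid_mem_specht (T : Tableau la n) : T.polytabloid ∈ (specht la n).toSubmodule :=
  Submodule.subset_span ⟨T, rfl⟩

theorem Tableau.col_injective_of_colOp_ne_zero (T : Tableau la n) {t : Fin n → ℕ}
    (h : T.colOp (Finsupp.single t 1) ≠ 0) (x y : Fin n)
    (hcol : (T.symm x).1.2 = (T.symm y).1.2) (ht : t x = t y) : x = y := by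
  by_contra hxy
  exact h (T.colOp_single_eq_zero hxy hcol ht)

/-- Tabloids of shape `la` all have the minimal weight, so those not killed are column permutations
of the tabloid of `T` and go to plus or minus its polytabloid. -/
theorem Tableau.colOp_mem_span (T : Tableau la n) {v : (Fin n → ℕ) →₀ ℚ}
    (hv : v ∈ tabloidSpan la n) : T.colOp v ∈ Submodule.span ℚ {T.polytabloid} := by
  suffices h : tabloidSpan la n ≤ (Submodule.span ℚ {T.polytabloid}).comap T.colOp from h hv
  refine Submodule.span_le.2 ?_
  rintro _ ⟨T', rfl⟩
  rw [SetLike.mem_coe, Submodule.mem_comap]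
  by_cases h0 : T.colOp (Finsupp.single T'.tabloid 1) = 0
  · rw [h0]; exact Submodule.zero_mem _
  · obtain ⟨h, hh, ht⟩ := (T.rowSum_le (T.col_injective_of_colOp_ne_zero h0)).2 T'.sum_tabloid
    have : Finsupp.single T'.tabloid (1 : ℚ) = tabloidRep n h⁻¹ (Finsupp.single T.tabloid 1) := by
      rw [tabloidRep_single, ht, inv_inv]
    change T.colOp (Finsupp.single T'.tabloid 1) ∈ _
    rw [this, colOp_tabloidRep (inv_mem_colStab hh), colOp_tabloid]
    exact Submodule.smul_mem _ _ (Submodule.mem_span_singleton_self _)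

/-- A weak form of the dominance criterion, sufficient to separate shapes. -/
theorem Tableau.rowSum_le_of_colOp_ne_zero (T : Tableau la n) {v : (Fin n → ℕ) →₀ ℚ}
    (hv : v ∈ tabloidSpan mu n) (h : T.colOp v ≠ 0) :
    rowSum la ≤ rowSum mu ∧ (rowSum mu = rowSum la → la = mu) := by
  have hex : ∃ T' : Tableau mu n, T.colOp (Finsupp.single T'.tabloid 1) ≠ 0 := by
    by_contra! hall
    refine h ?_
    suffices h : tabloidSpan mu n ≤ LinearMap.ker T.colOp from h hv
    refine Submodule.span_le.2 ?_
    rintro _ ⟨T', rfl⟩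
    exact hall T'
  obtain ⟨T', hT'⟩ := hex
  obtain ⟨h1, h2⟩ := T.rowSum_le (T.col_injective_of_colOp_ne_zero hT')
  rw [T'.sum_tabloid] at h1 h2
  refine ⟨h1, fun he => ?_⟩
  obtain ⟨g, -, hg⟩ := h2 he
  exact T.shape_eq T' g hg

/-! ### Homomorphisms between Specht modules -/

instance : FiniteDimensional ℚ (specht la n).toSubmodule :=
  FiniteDimensional.span_of_finite ℚ (Set.finite_range _)

theorem toRepresentation_apply_coe (g : Equiv.Perm (Fin n)) (v : (specht la n).toSubmodule) :
    ((specht la n).toRepresentation g v : (Fin n → ℕ) →₀ ℚ) = tabloidRep n g v := rfl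

/-- The polytabloid of `T` as a vector of the Specht module. -/
def Tableau.spechtVec (T : Tableau la n) : (specht la n).toSubmodule :=
  ⟨T.polytabloid, polytabloid_mem_specht T⟩

/-- The map `φ` commutes with the signed column sum, which multiplies the polytabloid of `T` by the
order of the column stabiliser. Hence `φ T.spechtVec` lies in the image of `T.colOp`. -/
theorem Tableau.colOp_intertwining (T : Tableau la n)
    (φ : Representation.IntertwiningMap (specht la n).toRepresentation
      (specht mu n).toRepresentation) :
    T.colOp (φ T.spechtVec) = (T.colStab.card : ℚ) • (φ T.spechtVec : (Fin n → ℕ) →₀ ℚ) := by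
  have h : ∑ g ∈ T.colStab, ((Equiv.Perm.sign g : ℤ) : ℚ) •
      (specht la n).toRepresentation g T.spechtVec = (T.colStab.card : ℚ) • T.spechtVec := by
    refine Subtype.ext ?_
    have := T.colOp_polytabloid
    rw [T.colOp_apply] at this
    simpa [toRepresentation_apply_coe, Tableau.spechtVec] using this
  have h2 := congrArg (fun w => (φ w : (Fin n → ℕ) →₀ ℚ)) h
  simp only [map_sum, map_smul, φ.isIntertwining] at h2
  rw [T.colOp_apply]
  simpa [toRepresentation_apply_coe] using h2

/-- The Specht module is cyclic: every polytabloid is a translate of that of `T`. -/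
theorem Tableau.intertwining_eq_zero (T : Tableau la n) {W : Type*} [AddCommGroup W] [Module ℚ W]
    {σ : Representation ℚ (Equiv.Perm (Fin n)) W}
    (φ : Representation.IntertwiningMap (specht la n).toRepresentation σ)
    (h : φ T.spechtVec = 0) : φ = 0 := by
  refine Representation.IntertwiningMap.ext (LinearMap.ext fun u => ?_)
  obtain ⟨u, hu⟩ := u
  change φ ⟨u, hu⟩ = 0
  suffices hs : (specht la n).toSubmodule ≤
      (LinearMap.ker φ.toLinearMap).map (specht la n).toSubmodule.subtype by
    obtain ⟨w, hw, hw'⟩ := hs hu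
    have : w = ⟨u, hu⟩ := Subtype.ext hw'
    rw [← this]
    exact hw
  refine Submodule.span_le.2 ?_
  rintro _ ⟨T', rfl⟩
  refine ⟨T'.spechtVec, ?_, rfl⟩
  have hg : T'.spechtVec = (specht la n).toRepresentation (T.symm.trans T') T.spechtVec := by
    refine Subtype.ext ?_
    rw [toRepresentation_apply_coe]
    change T'.polytabloid = tabloidRep n _ T.polytabloid
    rw [tabloidRep_polytabloid]
    congr 1
    ext x
    simp
  change φ T'.spechtVec = 0
  rw [hg, φ.isIntertwining, h, map_zero]

theorem Tableau.finrank_intertwining_self (T : Tableau la n) :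
    Module.finrank ℚ (Representation.IntertwiningMap (specht la n).toRepresentation
      (specht la n).toRepresentation) = 1 := by
  refine finrank_eq_one (Representation.IntertwiningMap.id (specht la n).toRepresentation) ?_
    fun φ => ?_
  · intro h
    refine T.polytabloid_ne_zero ?_
    have := congrArg (fun φ => (φ T.spechtVec : (Fin n → ℕ) →₀ ℚ)) h
    exact this
  · have h1 := T.colOp_mem_span (specht_le_tabloidSpan (φ T.spechtVec).2)
    rw [T.colOp_intertwining, Submodule.mem_span_singleton] at h1
    obtain ⟨c, hc⟩ := h1
    refine ⟨(T.colStab.card : ℚ)⁻¹ * c, ?_⟩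
    refine (sub_eq_zero.1 (T.intertwining_eq_zero _ ?_))
    refine Subtype.ext ?_
    change ((T.colStab.card : ℚ)⁻¹ * c) • T.polytabloid - (φ T.spechtVec : (Fin n → ℕ) →₀ ℚ) = 0
    rw [mul_smul, hc, smul_smul, inv_mul_cancel₀ T.colStab_card_ne_zero, one_smul, sub_self]

theorem Tableau.rowSum_le_of_intertwining (T : Tableau la n)
    (φ : Representation.IntertwiningMap (specht la n).toRepresentation
      (specht mu n).toRepresentation) (hφ : φ ≠ 0) :
    rowSum la ≤ rowSum mu ∧ (rowSum mu = rowSum la → la = mu) := by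
  refine T.rowSum_le_of_colOp_ne_zero (specht_le_tabloidSpan (φ T.spechtVec).2) ?_
  rw [T.colOp_intertwining]
  refine smul_ne_zero T.colStab_card_ne_zero fun h => hφ (T.intertwining_eq_zero φ ?_)
  exact Subtype.ext h

/-! ### Orthonormality of the Specht characters -/

theorem inner_apply (ψ χ : Equiv.Perm (Fin n) → ℚ) :
    inner n ψ χ = (n.factorial : ℚ)⁻¹ * ∑ g, ψ g⁻¹ * χ g := by
  simp [inner]

theorem inner_character {V W : Type*} [AddCommGroup V] [Module ℚ V] [FiniteDimensional ℚ V]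
    [AddCommGroup W] [Module ℚ W] [FiniteDimensional ℚ W]
    (ρ : Representation ℚ (Equiv.Perm (Fin n)) V) (σ : Representation ℚ (Equiv.Perm (Fin n)) W) :
    inner n ρ.character σ.character =
      Module.finrank ℚ (Representation.IntertwiningMap ρ σ) := by
  have hc : (Nat.card (Equiv.Perm (Fin n)) : ℚ) = n.factorial := by
    simp [Nat.card_eq_fintype_card, Fintype.card_perm]
  have : Invertible (Nat.card (Equiv.Perm (Fin n)) : ℚ) :=
    invertibleOfNonzero (by rw [hc]; exact_mod_cast n.factorial_ne_zero)
  rw [← Representation.card_inv_mul_sum_char_mul_char_eq_finrank, hc, inner_apply]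
  simp_rw [mul_comm]

theorem spechtChar_conj (la : YoungDiagram) (g h : Equiv.Perm (Fin n)) :
    spechtChar la n (h * g * h⁻¹) = spechtChar la n g :=
  Representation.char_conj _ g h

/-- A permutation has the cycle type of its inverse, hence is conjugate to it. -/
theorem spechtChar_inv (la : YoungDiagram) (g : Equiv.Perm (Fin n)) :
    spechtChar la n g⁻¹ = spechtChar la n g := by
  have h : IsConj g g⁻¹ := by
    rw [Equiv.Perm.isConj_iff_cycleType_eq, Equiv.Perm.cycleType_inv]
  obtain ⟨c, hc⟩ := isConj_iff.1 h
  rw [← hc, spechtChar_conj]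

theorem inner_comm (ψ χ : Equiv.Perm (Fin n) → ℚ) : inner n ψ χ = inner n χ ψ := by
  rw [inner_apply, inner_apply, ← Equiv.sum_comp (Equiv.inv _)]
  simp [mul_comm]

theorem nonempty_tableau (h : la.card = n) : Nonempty (Tableau la n) :=
  ⟨Fintype.equivFinOfCardEq (by simpa using h)⟩

theorem inner_spechtChar_self (h : la.card = n) :
    inner n (spechtChar la n) (spechtChar la n) = 1 := by
  obtain ⟨T⟩ := nonempty_tableau h
  rw [spechtChar, inner_character, T.finrank_intertwining_self, Nat.cast_one]

theorem exists_intertwining_of_inner_ne_zero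
    (h : inner n (spechtChar la n) (spechtChar mu n) ≠ 0) :
    ∃ φ : Representation.IntertwiningMap (specht la n).toRepresentation
      (specht mu n).toRepresentation, φ ≠ 0 := by
  rw [spechtChar, spechtChar, inner_character] at h
  by_contra! hall
  have : Subsingleton (Representation.IntertwiningMap (specht la n).toRepresentation
      (specht mu n).toRepresentation) := ⟨fun a b => by rw [hall a, hall b]⟩
  exact h (by rw [Module.finrank_zero_of_subsingleton, Nat.cast_zero])

/-- The inner product is symmetric, so if it is nonzero there are nonzero maps both ways. The row
sums then agree, and so do the shapes. -/
theorem inner_spechtChar_of_ne (hla : la.card = n) (hmu : mu.card = n) (hne : la ≠ mu) :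
    inner n (spechtChar la n) (spechtChar mu n) = 0 := by
  by_contra h
  obtain ⟨T⟩ := nonempty_tableau hla
  obtain ⟨T'⟩ := nonempty_tableau hmu
  obtain ⟨φ, hφ⟩ := exists_intertwining_of_inner_ne_zero h
  rw [inner_comm] at h
  obtain ⟨ψ, hψ⟩ := exists_intertwining_of_inner_ne_zero h
  have h1 := T.rowSum_le_of_intertwining φ hφ
  have h2 := T'.rowSum_le_of_intertwining ψ hψ
  exact hne (h1.2 (le_antisymm h2.1 h1.1))

theorem spechtChar_eq_zero (h : la.card ≠ n) : spechtChar la n = 0 := by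
  have : IsEmpty (Tableau la n) := ⟨fun T => h (by simpa using Fintype.card_congr T)⟩
  have hs : (specht la n).toSubmodule = ⊥ := by
    simp [specht, Set.range_eq_empty]
  have : Subsingleton (specht la n).toSubmodule := by rw [hs]; infer_instance
  funext g
  change LinearMap.trace ℚ _ _ = 0
  rw [Subsingleton.elim ((specht la n).toRepresentation g) 0, map_zero]

theorem spechtChar_one (la : YoungDiagram) :
    spechtChar la n 1 = Module.finrank ℚ (specht la n).toSubmodule :=
  Representation.char_one _

theorem spechtChar_one_pos (h : la.card = n) : 0 < spechtChar la n 1 := by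
  obtain ⟨T⟩ := nonempty_tableau h
  rw [spechtChar_one, Nat.cast_pos, Module.finrank_pos_iff]
  refine ⟨⟨T.spechtVec, 0, fun h => T.polytabloid_ne_zero ?_⟩⟩
  exact congrArg Subtype.val h

end Tableaux

/-! ### Restriction of Specht modules: the lower bound -/

section Restriction

variable {la mu : YoungDiagram} {n : ℕ}

theorem incl_castSucc (k : Equiv.Perm (Fin n)) (x : Fin n) :
    incl n k x.castSucc = (k x).castSucc :=
  Equiv.Perm.viaEmbedding_apply k Fin.castSuccEmb x

theorem incl_last (k : Equiv.Perm (Fin n)) : incl n k (Fin.last n) = Fin.last n :=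
  Equiv.Perm.viaEmbedding_apply_of_notMem k Fin.castSuccEmb _ (by
    rintro ⟨x, hx⟩
    exact Fin.castSucc_ne_last x hx)

theorem incl_injective (n : ℕ) : Function.Injective (incl n) :=
  Equiv.Perm.viaEmbeddingHom_injective _

theorem sign_incl (k : Equiv.Perm (Fin n)) : Equiv.Perm.sign (incl n k) = Equiv.Perm.sign k := by
  classical
  convert! Equiv.Perm.sign_extendDomain k (Equiv.ofInjective _ (Fin.castSuccEmb (n := n)).injective)
  ext x
  induction x using Fin.lastCases with
  | last =>
    rw [incl_last, Equiv.Perm.extendDomain_apply_not_subtype]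
    rintro ⟨y, hy⟩
    exact Fin.castSucc_ne_last y hy
  | cast x =>
    rw [incl_castSucc]
    exact (congrArg Fin.val (Equiv.Perm.extendDomain_apply_image k
      (Equiv.ofInjective _ (Fin.castSuccEmb (n := n)).injective) x)).symm

theorem exists_incl_eq {g : Equiv.Perm (Fin (n + 1))} (hg : g (Fin.last n) = Fin.last n) :
    ∃ k, incl n k = g := by
  have hex : ∀ x : Fin n, ∃ y : Fin n, g x.castSucc = y.castSucc := by
    intro x
    have hne : g x.castSucc ≠ Fin.last n := fun h =>
      Fin.castSucc_ne_last x (g.injective (h.trans hg.symm))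
    exact ⟨(g x.castSucc).castPred hne, by simp⟩
  choose k hk using hex
  have hinj : Function.Injective k := fun x y h => by
    have := hk x
    rw [h, ← hk y] at this
    exact Fin.castSucc_injective _ (g.injective this)
  refine ⟨Equiv.ofBijective k (Finite.injective_iff_bijective.1 hinj), Equiv.ext fun x => ?_⟩
  induction x using Fin.lastCases with
  | last => rw [incl_last, hg]
  | cast x => rw [incl_castSucc, hk]; rfl

/-- Delete the last entry from the tabloids in which it lies in row `i`, and kill the others. -/
def deleteLast (n i : ℕ) : ((Fin (n + 1) → ℕ) →₀ ℚ) →ₗ[ℚ] ((Fin n → ℕ) →₀ ℚ) :=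
  Finsupp.linearCombination ℚ fun t =>
    if t (Fin.last n) = i then Finsupp.single (fun x => t x.castSucc) 1 else 0

theorem deleteLast_single (i : ℕ) (t : Fin (n + 1) → ℕ) :
    deleteLast n i (Finsupp.single t 1) =
      if t (Fin.last n) = i then Finsupp.single (fun x => t x.castSucc) 1 else 0 := by
  simp [deleteLast]

theorem deleteLast_tabloidRep (i : ℕ) (g : Equiv.Perm (Fin n)) (v : (Fin (n + 1) → ℕ) →₀ ℚ) :
    deleteLast n i (tabloidRep (n + 1) (incl n g) v) = tabloidRep n g (deleteLast n i v) := by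
  suffices h : deleteLast n i ∘ₗ tabloidRep (n + 1) (incl n g) =
      tabloidRep n g ∘ₗ deleteLast n i from LinearMap.congr_fun h v
  refine Finsupp.lhom_ext' fun t => LinearMap.ext_ring ?_
  simp only [LinearMap.comp_apply, Finsupp.lsingle_apply]
  rw [tabloidRep_single, deleteLast_single, deleteLast_single, ← map_inv, incl_last]
  split_ifs
  · rw [tabloidRep_single]
    simp only [incl_castSucc]
  · simp

/-- `T'` is the restriction to the smaller diagram of the tableau `T`, which has its last entry
in the cell `c`. -/
theorem exists_tableau_extend {c : ℕ × ℕ} (hc : c ∉ la.cells)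
    (hmu : mu.cells = insert c la.cells) (T' : Tableau la n) :
    ∃ T : Tableau mu (n + 1), (T.symm (Fin.last n)).1 = c ∧
      ∀ x, (T.symm (Fin.castSucc x)).1 = (T'.symm x).1 := by
  have hcm : c ∈ mu.cells := by simp [hmu]
  have hm : ∀ x : Fin n, (T'.symm x).1 ∈ mu.cells := fun x => by
    rw [hmu]; exact Finset.mem_insert_of_mem (T'.symm x).2
  let f : Fin (n + 1) → {x // x ∈ mu.cells} :=
    Fin.lastCases ⟨c, hcm⟩ fun x => ⟨(T'.symm x).1, hm x⟩
  have hf1 : f (Fin.last n) = ⟨c, hcm⟩ := by simp [f]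
  have hf2 : ∀ x : Fin n, f x.castSucc = ⟨(T'.symm x).1, hm x⟩ := fun x => by simp [f]
  have hbij : Function.Bijective f := by
    constructor
    · intro x y hxy
      induction x using Fin.lastCases with
      | last =>
        induction y using Fin.lastCases with
        | last => rfl
        | cast y =>
          rw [hf1, hf2] at hxy
          refine absurd (T'.symm y).2 ?_
          rwa [← congrArg Subtype.val hxy]
      | cast x =>
        induction y using Fin.lastCases with
        | last =>
          rw [hf1, hf2] at hxy
          refine absurd (T'.symm x).2 ?_
          rwa [congrArg Subtype.val hxy]
        | cast y =>
          rw [hf2, hf2] at hxy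
          have : T'.symm x = T'.symm y := Subtype.ext (congrArg (fun c => c.1) hxy)
          rw [T'.symm.injective this]
    · rintro ⟨d, hd⟩
      have hd' := hd
      rw [hmu, Finset.mem_insert] at hd'
      rcases hd' with rfl | hd'
      · exact ⟨Fin.last n, hf1⟩
      · exact ⟨(T' ⟨d, hd'⟩).castSucc, by rw [hf2]; simp⟩
  refine ⟨(Equiv.ofBijective f hbij).symm, ?_, fun x => ?_⟩
  · simp [hf1]
  · simp [hf2]

/-- Only column permutations that keep the last entry in its row survive. Keeping its column as
well, they fix it, so they are the column permutations of `T'`. -/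
theorem deleteLast_polytabloid {c : ℕ × ℕ} {T : Tableau mu (n + 1)} {T' : Tableau la n}
    (hlast : (T.symm (Fin.last n)).1 = c)
    (hcast : ∀ x, (T.symm (Fin.castSucc x)).1 = (T'.symm x).1) :
    deleteLast n c.1 T.polytabloid = T'.polytabloid := by
  have hzero : ∀ g ∈ T.colStab, g ∉ (incl n) '' T'.colStab →
      deleteLast n c.1 (tabloidRep (n + 1) g (Finsupp.single T.tabloid 1)) = 0 := by
    intro g hg hgn
    rw [tabloidRep_single, deleteLast_single, if_neg]
    intro h
    have hfix : g⁻¹ (Fin.last n) = Fin.last n := by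
      refine T.eq_of_row_of_col ?_ (Tableau.mem_colStab.1 (Tableau.inv_mem_colStab hg) _)
      rw [h, Tableau.tabloid, hlast]
    have hfix' : g (Fin.last n) = Fin.last n := by
      rw [Equiv.Perm.inv_eq_iff_eq] at hfix
      exact hfix.symm
    obtain ⟨k, rfl⟩ := exists_incl_eq hfix'
    refine hgn ⟨k, ?_, rfl⟩
    rw [Finset.mem_coe, Tableau.mem_colStab] at *
    intro x
    have := hg x.castSucc
    rwa [incl_castSucc, hcast, hcast] at this
  rw [Tableau.polytabloid, Tableau.polytabloid, map_sum]
  refine (Finset.sum_of_injOn (incl n) (incl_injective n).injOn ?_ ?_ ?_).symm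
  · intro k hk
    rw [Finset.mem_coe, Tableau.mem_colStab] at *
    intro x
    induction x using Fin.lastCases with
    | last => rw [incl_last]
    | cast x => rw [incl_castSucc, hcast, hcast, hk]
  · intro g hg hgn
    rw [map_smul, hzero g hg hgn, smul_zero]
  · intro k _
    rw [map_smul, sign_incl, deleteLast_tabloidRep, deleteLast_single, if_pos]
    · congr 4
      funext x
      rw [Tableau.tabloid, Tableau.tabloid, hcast]
    · rw [Tableau.tabloid, hlast]

/-- The standard bilinear form. -/
def pairing (n : ℕ) : ((Fin n → ℕ) →₀ ℚ) →ₗ[ℚ] ((Fin n → ℕ) →₀ ℚ) →ₗ[ℚ] ℚ :=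
  Finsupp.linearCombination ℚ fun t => Finsupp.lapply t

theorem pairing_apply (v w : (Fin n → ℕ) →₀ ℚ) : pairing n v w = v.sum fun t a => a * w t := by
  simp [pairing, Finsupp.linearCombination_apply, Finsupp.sum]

theorem pairing_comm (v w : (Fin n → ℕ) →₀ ℚ) : pairing n v w = pairing n w v := by
  suffices h : pairing n = (pairing n).flip from LinearMap.congr_fun₂ h v w
  refine Finsupp.lhom_ext' fun s => LinearMap.ext_ring ?_
  refine Finsupp.lhom_ext' fun t => LinearMap.ext_ring ?_
  simp [pairing, Finsupp.single_apply, eq_comm]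

theorem pairing_tabloidRep (g : Equiv.Perm (Fin n)) (v w : (Fin n → ℕ) →₀ ℚ) :
    pairing n (tabloidRep n g v) w = pairing n v (tabloidRep n g⁻¹ w) := by
  induction v using Finsupp.induction_linear with
  | zero => simp
  | add v w hv hw => simp only [map_add, LinearMap.add_apply, hv, hw]
  | single t c =>
    rw [tabloidRep_single, pairing_apply, pairing_apply, Finsupp.sum_single_index (by simp),
      Finsupp.sum_single_index (by simp), tabloidRep_apply]

theorem pairing_self_pos {v : (Fin n → ℕ) →₀ ℚ} (hv : v ≠ 0) : 0 < pairing n v v := by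
  rw [pairing_apply]
  refine Finset.sum_pos (fun t ht => ?_) (Finsupp.support_nonempty_iff.2 hv)
  exact mul_self_pos.2 (Finsupp.mem_support_iff.1 ht)

/-- The tableaux of a given shape form a finite type. -/
instance : Fintype (Tableau la n) := inferInstanceAs (Fintype (_ ≃ _))

/-- A scalar multiple of the orthogonal projection to the Specht module. -/
def toSpecht (la : YoungDiagram) (n : ℕ) :
    ((Fin n → ℕ) →₀ ℚ) →ₗ[ℚ] (specht la n).toSubmodule :=
  ∑ T : Tableau la n, (pairing n T.polytabloid).smulRight T.spechtVec

theorem toSpecht_coe (v : (Fin n → ℕ) →₀ ℚ) :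
    (toSpecht la n v : (Fin n → ℕ) →₀ ℚ) =
      ∑ T : Tableau la n, pairing n T.polytabloid v • T.polytabloid := by
  simp [toSpecht, Tableau.spechtVec]

theorem toSpecht_tabloidRep (g : Equiv.Perm (Fin n)) (v : (Fin n → ℕ) →₀ ℚ) :
    toSpecht la n (tabloidRep n g v) = (specht la n).toRepresentation g (toSpecht la n v) := by
  refine Subtype.ext ?_
  rw [toRepresentation_apply_coe, toSpecht_coe, toSpecht_coe, map_sum]
  refine (Fintype.sum_equiv (Equiv.equivCongr (Equiv.refl _) g) _ _ fun T => ?_).symm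
  have : Equiv.equivCongr (Equiv.refl _) g T = (T.trans g : Tableau la n) := by
    ext; simp
  rw [this, map_smul, ← tabloidRep_polytabloid, pairing_tabloidRep, ← tabloidRep_mul_apply]
  simp

/-- Pairing with the polytabloid of `T` gives a sum of squares whose term at `T` is positive. -/
theorem toSpecht_polytabloid_ne_zero (T : Tableau la n) : toSpecht la n T.polytabloid ≠ 0 := by
  intro h
  have h1 := congrArg (fun w : (specht la n).toSubmodule =>
    pairing n T.polytabloid (w : (Fin n → ℕ) →₀ ℚ)) h
  simp only [toSpecht_coe, map_sum, map_smul, smul_eq_mul] at h1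
  rw [Submodule.coe_zero, map_zero] at h1
  refine absurd h1 (ne_of_gt (Finset.sum_pos' (fun T' _ => ?_) ⟨T, Finset.mem_univ _, ?_⟩))
  · rw [pairing_comm]
    exact mul_self_nonneg _
  · exact mul_self_pos.2 (pairing_self_pos T.polytabloid_ne_zero).ne'

/-- The multiplicity of the Specht module of shape `la` in the restriction of that of shape `mu`. -/
def mult (la mu : YoungDiagram) (n : ℕ) : ℚ :=
  inner n (spechtChar la n) (res n (spechtChar mu (n + 1)))

theorem mult_eq_finrank (la mu : YoungDiagram) (n : ℕ) :
    mult la mu n = Module.finrank ℚ (Representation.IntertwiningMap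
      ((specht mu (n + 1)).toRepresentation.comp (incl n)) (specht la n).toRepresentation) := by
  rw [mult, inner_comm, ← inner_character]
  rfl

theorem mult_nonneg (la mu : YoungDiagram) (n : ℕ) : 0 ≤ mult la mu n := by
  rw [mult_eq_finrank]
  exact Nat.cast_nonneg _

theorem finrank_intertwining_pos {G V W : Type*} [Group G] [AddCommGroup V] [Module ℚ V]
    [FiniteDimensional ℚ V] [AddCommGroup W] [Module ℚ W] [FiniteDimensional ℚ W]
    {ρ : Representation ℚ G V} {σ : Representation ℚ G W}
    {φ : Representation.IntertwiningMap ρ σ} (hφ : φ ≠ 0) :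
    0 < Module.finrank ℚ (Representation.IntertwiningMap ρ σ) := by
  rw [← (Representation.invariantsEquivIntertwiningMap ρ σ).finrank_eq,
    Module.finrank_pos_iff_exists_ne_zero]
  exact ⟨(Representation.invariantsEquivIntertwiningMap ρ σ).symm φ,
    (LinearEquiv.map_ne_zero_iff _).2 hφ⟩

theorem exists_cells_eq_insert (hle : la ≤ mu) (hcard : mu.card = la.card + 1) :
    ∃ c, c ∉ la.cells ∧ mu.cells = insert c la.cells := by
  have hs : la.cells ⊆ mu.cells := YoungDiagram.cells_subset_iff.2 hle
  have : (mu.cells \ la.cells).card = 1 := by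
    rw [Finset.card_sdiff_of_subset hs]
    change mu.card - la.card = 1
    omega
  obtain ⟨c, hc⟩ := Finset.card_eq_one.1 this
  refine ⟨c, ?_, ?_⟩
  · have : c ∈ mu.cells \ la.cells := by simp [hc]
    exact (Finset.mem_sdiff.1 this).2
  · rw [← Finset.sdiff_union_of_subset hs, hc]
    rfl

/-- Deleting the last entry need not map the Specht module of `mu` into that of `la`, so it is
followed by `toSpecht`. The composite is nonzero on the polytabloid of a tableau with its last entry
in the extra cell. -/
theorem one_le_mult (hle : la ≤ mu) (hla : la.card = n) (hmu : mu.card = n + 1) :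
    1 ≤ mult la mu n := by
  rw [mult_eq_finrank, Nat.one_le_cast]
  obtain ⟨c, hc, hins⟩ := exists_cells_eq_insert hle (by omega)
  obtain ⟨T'⟩ := nonempty_tableau hla
  obtain ⟨T, h1, h2⟩ := exists_tableau_extend hc hins T'
  let φ := toSpecht la n ∘ₗ deleteLast n c.1 ∘ₗ (specht mu (n + 1)).toSubmodule.subtype
  have hφ : ∀ (g : Equiv.Perm (Fin n)) (v : (specht mu (n + 1)).toSubmodule),
      φ ((specht mu (n + 1)).toRepresentation.comp (incl n) g v) =
        (specht la n).toRepresentation g (φ v) := by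
    intro g v
    change _ = (specht la n).toRepresentation g (toSpecht la n (deleteLast n c.1 v))
    rw [← toSpecht_tabloidRep, ← deleteLast_tabloidRep]
    rfl
  refine finrank_intertwining_pos (φ := φ.intertwiningMap_of_isIntertwiningMap _ _ hφ)
    fun h => ?_
  have h3 : φ T.spechtVec = 0 := congrArg (fun ψ => ψ T.spechtVec) h
  refine toSpecht_polytabloid_ne_zero T' ?_
  rw [← deleteLast_polytabloid h1 h2]
  exact h3

end Restriction

/-! ### Adding and removing cells -/

section YoungLattice

variable {la mu nu : YoungDiagram} {n : ℕ}

theorem mem_partitions : la ∈ partitions n ↔ la.card = n := by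
  simp [partitions]

theorem rowLen_eq_of_forall_mem {k l : ℕ} (h : ∀ j, (k, j) ∈ la ↔ j < l) : la.rowLen k = l := by
  have h' : ∀ j, j < la.rowLen k ↔ j < l := fun j => by
    rw [← YoungDiagram.mem_iff_lt_rowLen, h]
  exact le_antisymm (not_lt.1 fun hl => lt_irrefl _ ((h' _).1 hl))
    (not_lt.1 fun hl => lt_irrefl _ ((h' _).2 hl))

/-- `mu` arises from `la` by adding a cell at the end of row `i`. -/
def AddsCell (la : YoungDiagram) (i : ℕ) (mu : YoungDiagram) : Prop :=
  mu.cells = insert (i, la.rowLen i) la.cells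

theorem AddsCell.notMem (la : YoungDiagram) (i : ℕ) : (i, la.rowLen i) ∉ la.cells := by
  rw [YoungDiagram.mem_cells, YoungDiagram.mem_iff_lt_rowLen]
  exact lt_irrefl _

theorem AddsCell.mem_iff {i : ℕ} (h : AddsCell la i mu) {c : ℕ × ℕ} :
    c ∈ mu ↔ c = (i, la.rowLen i) ∨ c ∈ la := by
  rw [← YoungDiagram.mem_cells, h, Finset.mem_insert, YoungDiagram.mem_cells]

theorem AddsCell.rowLen {i : ℕ} (h : AddsCell la i mu) (k : ℕ) :
    mu.rowLen k = la.rowLen k + if k = i then 1 else 0 := by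
  refine rowLen_eq_of_forall_mem fun j => ?_
  rw [h.mem_iff, YoungDiagram.mem_iff_lt_rowLen, Prod.mk.injEq]
  split_ifs with hk
  · subst hk; omega
  · simp [hk]

theorem AddsCell.le {i : ℕ} (h : AddsCell la i mu) : la ≤ mu :=
  YoungDiagram.cells_subset_iff.1 (by rw [h]; exact Finset.subset_insert _ _)

theorem AddsCell.card {i : ℕ} (h : AddsCell la i mu) : mu.card = la.card + 1 := by
  change mu.cells.card = _
  rw [h, Finset.card_insert_of_notMem (AddsCell.notMem la i)]

theorem AddsCell.lt_rowLen {i : ℕ} (h : AddsCell la i mu) {j : ℕ} (hj : j < i) :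
    la.rowLen i < la.rowLen j := by
  have h1 := mu.rowLen_anti j i hj.le
  rw [h.rowLen, h.rowLen, if_pos rfl, if_neg hj.ne] at h1
  omega

theorem AddsCell.rowLen_succ_lt {i : ℕ} (h : AddsCell la i mu) :
    mu.rowLen (i + 1) < mu.rowLen i := by
  have h1 := la.rowLen_anti i (i + 1) (by omega)
  rw [h.rowLen, h.rowLen, if_pos rfl, if_neg (by omega)]
  omega

theorem AddsCell.row_unique {i k : ℕ} (h : AddsCell la i mu) (h' : AddsCell la k mu) : i = k := by
  have h1 := h.rowLen i
  rw [h'.rowLen, if_pos rfl] at h1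
  split_ifs at h1 with hik
  · exact hik
  · omega

theorem AddsCell.unique {i : ℕ} (h : AddsCell la i mu) (h' : AddsCell la i nu) : mu = nu :=
  YoungDiagram.ext (h.trans h'.symm)

theorem AddsCell.unique_left {i : ℕ} (h : AddsCell la i nu) (h' : AddsCell mu i nu) : la = mu := by
  refine eq_of_rowLen_eq fun k => ?_
  have h1 := h.rowLen k
  rw [h'.rowLen] at h1
  omega

theorem exists_addsCell_iff : (∃ i, AddsCell la i mu) ↔ la ≤ mu ∧ mu.card = la.card + 1 := by
  constructor
  · rintro ⟨i, h⟩
    exact ⟨h.le, h.card⟩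
  · rintro ⟨hle, hcard⟩
    obtain ⟨⟨i, j⟩, hc, hins⟩ := exists_cells_eq_insert hle hcard
    refine ⟨i, ?_⟩
    suffices h : la.rowLen i = j by rw [AddsCell, h, hins]
    have hmem : ∀ d, d ∈ mu ↔ d = (i, j) ∨ d ∈ la := fun d => by
      rw [← YoungDiagram.mem_cells, hins, Finset.mem_insert, YoungDiagram.mem_cells]
    rw [YoungDiagram.mem_cells, YoungDiagram.mem_iff_lt_rowLen] at hc
    by_contra hne
    have hmu : (i, j) ∈ mu := (hmem _).2 (Or.inl rfl)
    have h1 : (i, la.rowLen i) ∈ mu := mu.up_left_mem le_rfl (by omega) hmu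
    rw [hmem, YoungDiagram.mem_iff_lt_rowLen, Prod.mk.injEq] at h1
    omega

theorem exists_addsCell {i : ℕ} (h : ∀ j < i, la.rowLen i < la.rowLen j) :
    ∃ mu, AddsCell la i mu := by
  refine ⟨⟨insert (i, la.rowLen i) la.cells, ?_⟩, rfl⟩
  rintro ⟨a, b⟩ ⟨c, d⟩ hle hm
  rw [Prod.mk_le_mk] at hle
  rw [Finset.mem_coe, Finset.mem_insert, YoungDiagram.mem_cells, YoungDiagram.mem_iff_lt_rowLen,
    Prod.mk.injEq] at hm ⊢
  rcases hm with ⟨rfl, rfl⟩ | hm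
  · rcases hle.1.eq_or_lt with rfl | hlt
    · omega
    · have := h c hlt
      right; omega
  · have := la.rowLen_anti c a hle.1
    right; omega

theorem exists_addsCell_left {i : ℕ} (h : mu.rowLen (i + 1) < mu.rowLen i) :
    ∃ la, AddsCell la i mu := by
  have hlow : IsLowerSet ((mu.cells.erase (i, mu.rowLen i - 1) : Finset (ℕ × ℕ)) : Set (ℕ × ℕ)) := by
    rintro ⟨a, b⟩ ⟨c, d⟩ hle hm
    rw [Prod.mk_le_mk] at hle
    rw [Finset.mem_coe, Finset.mem_erase, YoungDiagram.mem_cells, YoungDiagram.mem_iff_lt_rowLen,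
      ne_eq, Prod.mk.injEq] at hm ⊢
    have h1 := mu.rowLen_anti c a hle.1
    refine ⟨?_, by omega⟩
    rintro ⟨rfl, rfl⟩
    rcases hle.1.eq_or_lt with rfl | hlt
    · omega
    · have := mu.rowLen_anti (c + 1) a hlt
      omega
  refine ⟨⟨mu.cells.erase (i, mu.rowLen i - 1), hlow⟩, ?_⟩
  have hr : YoungDiagram.rowLen ⟨mu.cells.erase (i, mu.rowLen i - 1), hlow⟩ i =
      mu.rowLen i - 1 := by
    refine rowLen_eq_of_forall_mem fun j => ?_
    rw [YoungDiagram.mem_mk, Finset.mem_erase, YoungDiagram.mem_cells,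
      YoungDiagram.mem_iff_lt_rowLen, ne_eq, Prod.mk.injEq]
    omega
  rw [AddsCell, hr, Finset.insert_erase]
  rw [YoungDiagram.mem_cells, YoungDiagram.mem_iff_lt_rowLen]
  omega

/-- The rows from which a cell can be removed. -/
def removableRows (la : YoungDiagram) : Finset ℕ :=
  (Finset.range (la.colLen 0)).filter fun i => la.rowLen (i + 1) < la.rowLen i

theorem mem_removableRows {i : ℕ} : i ∈ removableRows la ↔ la.rowLen (i + 1) < la.rowLen i := by
  rw [removableRows, Finset.mem_filter, Finset.mem_range, ← YoungDiagram.mem_iff_lt_colLen,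
    YoungDiagram.mem_iff_lt_rowLen]
  omega

open Classical in
theorem card_lower (hla : la.card = n + 1) :
    ((partitions n).filter (· ≤ la)).card = (removableRows la).card := by
  symm
  have hex : ∀ i ∈ removableRows la, ∃ nu, AddsCell nu i la := fun i hi =>
    exists_addsCell_left (mem_removableRows.1 hi)
  choose f hf using hex
  refine Finset.card_bij f ?_ ?_ ?_
  · intro i hi
    rw [Finset.mem_filter, mem_partitions]
    have := (hf i hi).card
    exact ⟨by omega, (hf i hi).le⟩
  · intro i hi k hk h
    exact (hf i hi).row_unique (h ▸ hf k hk)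
  · intro nu hnu
    rw [Finset.mem_filter, mem_partitions] at hnu
    obtain ⟨i, hi⟩ := exists_addsCell_iff.2 ⟨hnu.2, by omega⟩
    have hm := mem_removableRows.2 hi.rowLen_succ_lt
    exact ⟨i, hm, (hf i hm).unique_left hi⟩

-- A cell can be added in row `0` and in the row just below each removable one, so there is one more
-- addable row than removable rows.
open Classical in
theorem card_upper (hla : la.card = n) :
    ((partitions (n + 1)).filter (la ≤ ·)).card = (removableRows la).card + 1 := by
  have h0 : (insert 0 ((removableRows la).image Nat.succ)).card = (removableRows la).card + 1 := by
    rw [Finset.card_insert_of_notMem (by simp), Finset.card_image_of_injective _ Nat.succ_injective]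
  rw [← h0]
  symm
  have hmem : ∀ i, i ∈ insert 0 ((removableRows la).image Nat.succ) ↔
      ∀ j < i, la.rowLen i < la.rowLen j := by
    intro i
    rw [Finset.mem_insert, Finset.mem_image]
    constructor
    · rintro (rfl | ⟨k, hk, rfl⟩) j hj
      · omega
      · rw [mem_removableRows] at hk
        exact lt_of_lt_of_le hk (la.rowLen_anti _ _ (by omega))
    · intro h
      rcases Nat.eq_zero_or_pos i with rfl | hi
      · exact Or.inl rfl
      · refine Or.inr ⟨i - 1, mem_removableRows.2 ?_, by omega⟩
        have := h (i - 1) (by omega)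
        rwa [Nat.sub_add_cancel hi]
  have hex : ∀ i ∈ insert 0 ((removableRows la).image Nat.succ), ∃ nu, AddsCell la i nu :=
    fun i hi => exists_addsCell ((hmem i).1 hi)
  choose f hf using hex
  refine Finset.card_bij f ?_ ?_ ?_
  · intro i hi
    rw [Finset.mem_filter, mem_partitions]
    have := (hf i hi).card
    exact ⟨by omega, (hf i hi).le⟩
  · intro i hi k hk h
    exact (hf i hi).row_unique (h ▸ hf k hk)
  · intro nu hnu
    rw [Finset.mem_filter, mem_partitions] at hnu
    obtain ⟨i, hi⟩ := exists_addsCell_iff.2 ⟨hnu.2, by omega⟩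
    have hm := (hmem i).2 fun j hj => hi.lt_rowLen hj
    exact ⟨i, hm, (hf i hm).unique hi⟩

/-! ### Counting paths in Young's lattice -/

open Classical in
/-- The indicator of containment. -/
def contains (la mu : YoungDiagram) : ℚ := if la ≤ mu then 1 else 0

theorem card_sup_add_card_inf (la mu : YoungDiagram) :
    (la ⊔ mu).card + (la ⊓ mu).card = la.card + mu.card := by
  change (la ⊔ mu).cells.card + (la ⊓ mu).cells.card = la.cells.card + mu.cells.card
  rw [YoungDiagram.cells_sup, YoungDiagram.cells_inf, Finset.card_union_add_card_inter]

theorem eq_of_le_of_card (h : la ≤ mu) (hc : mu.card ≤ la.card) : la = mu :=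
  YoungDiagram.ext (Finset.eq_of_subset_of_card_le (YoungDiagram.cells_subset_iff.2 h) hc)

theorem card_mono (h : la ≤ mu) : la.card ≤ mu.card :=
  Finset.card_le_card (YoungDiagram.cells_subset_iff.2 h)

theorem contains_mul_contains (la mu nu : YoungDiagram) :
    contains la nu * contains mu nu = contains (la ⊔ mu) nu := by
  classical
  simp only [contains, sup_le_iff, mul_ite, mul_one, mul_zero]
  split_ifs <;> simp_all

theorem contains_mul_contains' (la mu nu : YoungDiagram) :
    contains nu la * contains nu mu = contains nu (la ⊓ mu) := by
  classical
  simp only [contains, le_inf_iff, mul_ite, mul_one, mul_zero]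
  split_ifs <;> simp_all

open Classical in
theorem sum_contains_upper_self (hla : la.card = n) :
    ∑ nu ∈ partitions (n + 1), contains la nu = (removableRows la).card + 1 := by
  simp only [contains, Finset.sum_boole, card_upper hla]
  push_cast
  rfl

open Classical in
theorem sum_contains_lower_self (hla : la.card = n + 1) :
    ∑ nu ∈ partitions n, contains nu la = (removableRows la).card := by
  simp only [contains, Finset.sum_boole, card_lower hla]

-- Young's lattice is a differential poset. For distinct `la` and `mu` the only possible common
-- upper cover is the join, the only possible common lower cover is the meet, and by the sizes both
-- exist or neither does. For `la = mu` the surplus of addable rows gives the `1`.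
open Classical in
theorem sum_contains_upper (hla : la.card = n + 1) (hmu : mu.card = n + 1) :
    ∑ nu ∈ partitions (n + 2), contains la nu * contains mu nu =
      ∑ nu ∈ partitions n, contains nu la * contains nu mu + if la = mu then 1 else 0 := by
  simp only [contains_mul_contains, contains_mul_contains']
  have hcard := card_sup_add_card_inf la mu
  split_ifs with h
  · subst h
    rw [sup_idem, inf_idem, sum_contains_upper_self hla, sum_contains_lower_self hla]
  · have h1 : n + 2 ≤ (la ⊔ mu).card := by
      by_contra hlt
      have e1 := eq_of_le_of_card (le_sup_left (a := la) (b := mu)) (by omega)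
      have e2 := eq_of_le_of_card (le_sup_right (a := la) (b := mu)) (by omega)
      exact h (e1.trans e2.symm)
    rw [add_zero]
    rcases h1.eq_or_lt with h1 | h1
    · rw [Finset.sum_eq_single (la ⊔ mu), Finset.sum_eq_single (la ⊓ mu)]
      · simp [contains]
      · intro nu hnu hne
        rw [mem_partitions] at hnu
        exact if_neg fun hle => hne (eq_of_le_of_card hle (by omega))
      · intro hn
        exact absurd (mem_partitions.2 (by omega)) hn
      · intro nu hnu hne
        rw [mem_partitions] at hnu
        exact if_neg fun hle => hne (eq_of_le_of_card hle (by omega)).symm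
      · intro hn
        exact absurd (mem_partitions.2 (by omega)) hn
    · rw [Finset.sum_eq_zero, Finset.sum_eq_zero]
      · intro nu hnu
        rw [mem_partitions] at hnu
        exact if_neg fun hle => by have := card_mono hle; omega
      · intro nu hnu
        rw [mem_partitions] at hnu
        exact if_neg fun hle => by have := card_mono hle; omega

/-- The number of paths from the empty diagram to a diagram with `n` cells in Young's lattice. -/
def pathCount : ℕ → YoungDiagram → ℚ
  | 0, _ => 1
  | n + 1, mu => ∑ la ∈ partitions n, contains la mu * pathCount n la

theorem contains_nonneg (la mu : YoungDiagram) : 0 ≤ contains la mu := by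
  unfold contains
  split_ifs <;> simp

theorem pathCount_nonneg (n : ℕ) (la : YoungDiagram) : 0 ≤ pathCount n la := by
  induction n generalizing la with
  | zero => exact zero_le_one
  | succ n ih => exact Finset.sum_nonneg fun nu _ => mul_nonneg (contains_nonneg nu la) (ih nu)

theorem partitions_zero : partitions 0 = {⊥} := by
  ext la
  rw [mem_partitions, Finset.mem_singleton]
  constructor
  · intro h
    exact YoungDiagram.ext (Finset.card_eq_zero.1 h)
  · rintro rfl; rfl

theorem sum_upper_pathCount_eq (n : ℕ) (la : YoungDiagram) :
    ∑ mu ∈ partitions (n + 1), contains la mu * pathCount (n + 1) mu =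
      ∑ nu ∈ partitions n,
        (∑ mu ∈ partitions (n + 1), contains la mu * contains nu mu) * pathCount n nu := by
  simp only [pathCount, Finset.mul_sum, Finset.sum_mul, ← mul_assoc]
  exact Finset.sum_comm

/-- Going up after down is exchanged for down after up plus the identity, and induction applies one
level lower. -/
theorem sum_upper_pathCount (hla : la.card = n) :
    ∑ mu ∈ partitions (n + 1), contains la mu * pathCount (n + 1) mu = (n + 1) * pathCount n la := by
  classical
  induction n generalizing la with
  | zero =>
    have : la = ⊥ := YoungDiagram.ext (Finset.card_eq_zero.1 hla)
    subst this
    rw [sum_upper_pathCount_eq, partitions_zero, Finset.sum_singleton]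
    simp only [contains_mul_contains, sup_idem]
    rw [sum_contains_upper_self hla]
    simp [removableRows, pathCount, YoungDiagram.colLen_eq_card, YoungDiagram.col]
  | succ m ih =>
    have hstep : ∀ nu ∈ partitions (m + 1),
        (∑ mu ∈ partitions (m + 1 + 1), contains la mu * contains nu mu) * pathCount (m + 1) nu =
          (∑ ka ∈ partitions m, contains ka la * (contains ka nu * pathCount (m + 1) nu)) +
            if la = nu then pathCount (m + 1) nu else 0 := by
      intro nu hnu
      rw [sum_contains_upper hla (mem_partitions.1 hnu), add_mul, Finset.sum_mul]
      congr 1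
      · simp only [mul_assoc]
      · split_ifs <;> simp
    rw [sum_upper_pathCount_eq, Finset.sum_congr rfl hstep, Finset.sum_add_distrib, Finset.sum_ite_eq,
      if_pos (mem_partitions.2 hla), Finset.sum_comm]
    have h2 : ∀ ka ∈ partitions m,
        ∑ nu ∈ partitions (m + 1), contains ka la * (contains ka nu * pathCount (m + 1) nu) =
          (m + 1) * (contains ka la * pathCount m ka) := by
      intro ka hka
      rw [← Finset.mul_sum]
      rw [ih (mem_partitions.1 hka)]
      ring
    rw [Finset.sum_congr rfl h2, ← Finset.mul_sum]
    -- The remaining sum is the recursion for `pathCount (m + 1) la`. It occurs `m + 1` times, and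
    -- the indicator supplies one more copy.
    conv_lhs => arg 1; arg 2; change pathCount (m + 1) la
    push_cast
    ring

/-- One factor of each square is expanded by the recursion, and the other is summed over the upper
covers. -/
theorem sum_pathCount_sq (n : ℕ) :
    ∑ la ∈ partitions n, pathCount n la ^ 2 = n.factorial := by
  induction n with
  | zero => simp [partitions_zero, pathCount]
  | succ n ih =>
    have h : ∑ mu ∈ partitions (n + 1), pathCount (n + 1) mu ^ 2 =
        ∑ la ∈ partitions n, pathCount n la *
          ∑ mu ∈ partitions (n + 1), contains la mu * pathCount (n + 1) mu := by
      simp only [Finset.mul_sum]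
      rw [Finset.sum_comm]
      refine Finset.sum_congr rfl fun mu _ => ?_
      rw [sq]
      conv_lhs => arg 1; rw [pathCount]
      rw [Finset.sum_mul]
      refine Finset.sum_congr rfl fun la _ => ?_
      ring
    rw [h, Finset.sum_congr rfl fun la hla => by
      rw [sum_upper_pathCount (mem_partitions.1 hla)]]
    rw [Nat.factorial_succ, Nat.cast_mul, ← ih, Finset.mul_sum]
    refine Finset.sum_congr rfl fun la _ => ?_
    push_cast
    ring

end YoungLattice

/-! ### The branching rule -/

section Branching

variable {la mu : YoungDiagram} {n : ℕ}

/-- The regular character. -/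
def regChar (n : ℕ) : Equiv.Perm (Fin n) → ℚ := fun g => if g = 1 then n.factorial else 0

theorem inner_regChar (χ : Equiv.Perm (Fin n) → ℚ) : inner n (regChar n) χ = χ 1 := by
  rw [inner_apply, Finset.sum_eq_single 1]
  · have : (n.factorial : ℚ) ≠ 0 := by exact_mod_cast n.factorial_ne_zero
    simp [regChar, this]
  · intro g _ hg
    simp [regChar, hg]
  · simp

theorem res_regChar (n : ℕ) : res n (regChar (n + 1)) = ((n : ℚ) + 1) • regChar n := by
  funext g
  simp only [res, LinearMap.funLeft_apply, regChar, Pi.smul_apply, smul_eq_mul,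
    map_eq_one_iff (incl n) (incl_injective n)]
  split_ifs
  · rw [Nat.factorial_succ]; push_cast; ring
  · simp

theorem res_apply_one (χ : Equiv.Perm (Fin (n + 1)) → ℚ) : res n χ 1 = χ 1 := by
  simp [res, LinearMap.funLeft_apply]

/-- The part of the regular character that comes from the Specht modules. -/
def spechtReg (n : ℕ) : Equiv.Perm (Fin n) → ℚ :=
  ∑ la ∈ partitions n, spechtChar la n 1 • spechtChar la n

theorem inner_spechtChar_spechtReg (hla : la.card = n) :
    inner n (spechtChar la n) (spechtReg n) = spechtChar la n 1 := by
  classical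
  rw [spechtReg, map_sum, Finset.sum_eq_single la]
  · rw [map_smul, inner_spechtChar_self hla, smul_eq_mul, mul_one]
  · intro mu hmu hne
    rw [map_smul, inner_spechtChar_of_ne hla (mem_partitions.1 hmu) hne.symm, smul_zero]
  · intro h
    exact absurd (mem_partitions.2 hla) h

theorem inner_sum_left (s : Finset YoungDiagram) (c : YoungDiagram → ℚ)
    (f : YoungDiagram → Equiv.Perm (Fin n) → ℚ) (χ : Equiv.Perm (Fin n) → ℚ) :
    inner n (∑ la ∈ s, c la • f la) χ = ∑ la ∈ s, c la * inner n (f la) χ := by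
  rw [inner_comm, map_sum]
  refine Finset.sum_congr rfl fun la _ => ?_
  rw [map_smul, smul_eq_mul, inner_comm]

/-- The squared norm of the rest of the regular character: nonnegativity is Bessel's inequality,
vanishing is completeness. -/
theorem inner_regChar_sub_spechtReg (n : ℕ) :
    inner n (regChar n - spechtReg n) (regChar n - spechtReg n) =
      n.factorial - ∑ la ∈ partitions n, spechtChar la n 1 ^ 2 := by
  have h1 : inner n (spechtReg n) (spechtReg n) =
      ∑ la ∈ partitions n, spechtChar la n 1 ^ 2 := by
    nth_rewrite 1 [spechtReg]
    rw [inner_sum_left]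
    refine Finset.sum_congr rfl fun la hla => ?_
    rw [inner_spechtChar_spechtReg (mem_partitions.1 hla), sq]
  have h2 : inner n (regChar n) (spechtReg n) = ∑ la ∈ partitions n, spechtChar la n 1 ^ 2 := by
    rw [inner_regChar, spechtReg, Finset.sum_apply]
    simp [sq]
  have h3 : inner n (regChar n) (regChar n) = n.factorial := by
    rw [inner_regChar]; simp [regChar]
  rw [map_sub, inner_comm, map_sub, inner_comm (regChar n - _), map_sub, h3,
    inner_comm (spechtReg n) (regChar n), h2, h1]
  ring

/-- Invariance under inversion turns the bilinear form into a sum of squares, hence a positive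
definite one. -/
theorem inner_self_of_inv {ψ : Equiv.Perm (Fin n) → ℚ} (h : ∀ g, ψ g⁻¹ = ψ g) :
    inner n ψ ψ = (n.factorial : ℚ)⁻¹ * ∑ g, ψ g ^ 2 := by
  rw [inner_apply]
  simp only [h, sq]

theorem regChar_sub_spechtReg_inv (g : Equiv.Perm (Fin n)) :
    (regChar n - spechtReg n) g⁻¹ = (regChar n - spechtReg n) g := by
  simp [regChar, spechtReg, spechtChar_inv]

theorem sum_spechtChar_one_sq_le (n : ℕ) :
    ∑ la ∈ partitions n, spechtChar la n 1 ^ 2 ≤ n.factorial := by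
  rw [← sub_nonneg, ← inner_regChar_sub_spechtReg, inner_self_of_inv regChar_sub_spechtReg_inv]
  positivity

theorem regChar_eq_spechtReg
    (h : ∑ la ∈ partitions n, spechtChar la n 1 ^ 2 = n.factorial) : regChar n = spechtReg n := by
  have h1 := inner_regChar_sub_spechtReg n
  rw [h, sub_self, inner_self_of_inv regChar_sub_spechtReg_inv, mul_eq_zero, inv_eq_zero,
    Nat.cast_eq_zero, or_iff_right n.factorial_ne_zero,
    Finset.sum_eq_zero_iff_of_nonneg fun g _ => sq_nonneg _] at h1
  funext g
  simpa [sub_eq_zero] using h1 g (Finset.mem_univ g)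

theorem contains_le_mult (hla : la.card = n) (hmu : mu.card = n + 1) :
    contains la mu ≤ mult la mu n := by
  unfold contains
  split_ifs with h
  · exact one_le_mult h hla hmu
  · exact mult_nonneg _ _ _

/-- If the degrees for `n` are path numbers, their squares sum to `n!` and the regular character is
a sum of Specht characters. Pairing it with a restriction expresses each degree for `n + 1` through
multiplicities, hence bounds it below by the path number. The sums of squares leave no room for
strict inequality. -/
theorem spechtChar_one_eq_pathCount (hla : la.card = n) : spechtChar la n 1 = pathCount n la := by
  induction n generalizing la with
  | zero =>
    have h1 := sum_spechtChar_one_sq_le 0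
    have h2 := spechtChar_one_pos hla
    have hbot : la = ⊥ := YoungDiagram.ext (Finset.card_eq_zero.1 hla)
    subst hbot
    rw [partitions_zero, Finset.sum_singleton] at h1
    rw [spechtChar_one] at *
    rw [pathCount]
    have h3 : Module.finrank ℚ (specht ⊥ 0).toSubmodule ≤ 1 := by
      rw [Nat.factorial_zero] at h1
      by_contra! hlt
      have : (2 : ℚ) ≤ Module.finrank ℚ (specht ⊥ 0).toSubmodule := by exact_mod_cast hlt
      norm_num at h1
      nlinarith
    have h4 : 0 < Module.finrank ℚ (specht ⊥ 0).toSubmodule := by exact_mod_cast h2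
    exact_mod_cast (show Module.finrank ℚ (specht ⊥ 0).toSubmodule = 1 by omega)
  | succ n ih =>
    have hreg : regChar n = spechtReg n := by
      refine regChar_eq_spechtReg ?_
      rw [← sum_pathCount_sq]
      exact Finset.sum_congr rfl fun la hla => by rw [ih (mem_partitions.1 hla)]
    have hge : ∀ mu ∈ partitions (n + 1), pathCount (n + 1) mu ≤ spechtChar mu (n + 1) 1 := by
      intro mu hmu
      rw [← res_apply_one (spechtChar mu (n + 1)), ← inner_regChar (res n _), hreg,
        spechtReg, inner_sum_left, pathCount]
      refine Finset.sum_le_sum fun la hla => ?_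
      rw [mem_partitions] at hla hmu
      rw [ih hla, mul_comm]
      exact mul_le_mul_of_nonneg_left (contains_le_mult hla hmu) (pathCount_nonneg n la)
    have hsq : ∀ mu ∈ partitions (n + 1),
        pathCount (n + 1) mu ^ 2 ≤ spechtChar mu (n + 1) 1 ^ 2 := fun mu hmu =>
      pow_le_pow_left₀ (pathCount_nonneg _ _) (hge mu hmu) 2
    have heq := (Finset.sum_eq_sum_iff_of_le hsq).1 (le_antisymm (Finset.sum_le_sum hsq) (by
      rw [sum_pathCount_sq]
      exact sum_spechtChar_one_sq_le _))
    exact ((pow_left_inj₀ (pathCount_nonneg _ _) (spechtChar_one_pos hla).le two_ne_zero).1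
      (heq la (mem_partitions.2 hla))).symm

theorem regChar_eq (n : ℕ) : regChar n = spechtReg n := by
  refine regChar_eq_spechtReg ?_
  rw [← sum_pathCount_sq]
  exact Finset.sum_congr rfl fun la hla => by
    rw [spechtChar_one_eq_pathCount (mem_partitions.1 hla)]

/-- The branching rule: the multiplicity of `[la]` in the restriction of `[mu]`. -/
theorem mult_eq_contains (hla : la.card = n) (hmu : mu.card = n + 1) :
    mult la mu n = contains la mu := by
  -- The regular character restricts to `n + 1` times the regular character; both sides are paired
  -- with `[la]`.
  have h1 : ∑ nu ∈ partitions (n + 1), spechtChar nu (n + 1) 1 * mult la nu n =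
      (n + 1) * spechtChar la n 1 := by
    have h2 := congrArg (fun χ => inner n (spechtChar la n) (res n χ)) (regChar_eq (n + 1))
    simp only [res_regChar, spechtReg, map_sum, map_smul, smul_eq_mul] at h2
    rw [inner_comm, inner_regChar] at h2
    exact h2.symm
  have h3 := sum_upper_pathCount hla
  rw [← spechtChar_one_eq_pathCount hla, ← h1] at h3
  -- The weighted sums of `contains` and `mult` agree and the terms compare one by one, so each pair
  -- of terms is equal; the positive degree cancels.
  have hle : ∀ nu ∈ partitions (n + 1), contains la nu * pathCount (n + 1) nu ≤
      spechtChar nu (n + 1) 1 * mult la nu n := fun nu hnu => by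
    rw [mem_partitions] at hnu
    rw [spechtChar_one_eq_pathCount hnu, mul_comm]
    exact mul_le_mul_of_nonneg_left (contains_le_mult hla hnu) (pathCount_nonneg _ _)
  have h4 := (Finset.sum_eq_sum_iff_of_le hle).1 h3 mu (mem_partitions.2 hmu)
  rw [← spechtChar_one_eq_pathCount hmu, mul_comm] at h4
  exact (mul_left_cancel₀ (spechtChar_one_pos hmu).ne' h4).symm

/-! ### Frobenius reciprocity -/

theorem sum_conj_spechtChar (la : YoungDiagram) (F : Equiv.Perm (Fin n) → ℚ)
    (x : Equiv.Perm (Fin n)) :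
    ∑ g, spechtChar la n g⁻¹ * F (x * g * x⁻¹) = ∑ g, spechtChar la n g⁻¹ * F g := by
  refine Fintype.sum_equiv (MulAut.conj x).toEquiv _ _ fun g => ?_
  have : (x * g * x⁻¹)⁻¹ = x * g⁻¹ * x⁻¹ := by group
  change _ = spechtChar la n (x * g * x⁻¹)⁻¹ * F (x * g * x⁻¹)
  rw [this, spechtChar_conj]

/-- After the substitution by conjugation, all `(n + 1)!` elements `x` contribute equally, which
cancels the normalising factor of `S_{n+1}`. -/
theorem inner_ind (mu : YoungDiagram) (χ : Equiv.Perm (Fin n) → ℚ) :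
    inner (n + 1) (spechtChar mu (n + 1)) (ind n χ) =
      inner n (res n (spechtChar mu (n + 1))) χ := by
  have hind : ∀ g, ind n χ g = (n.factorial : ℚ)⁻¹ * ∑ x : Equiv.Perm (Fin (n + 1)),
      ∑ k : Equiv.Perm (Fin n), if incl n k = x * g * x⁻¹ then χ k else 0 := fun g => rfl
  rw [inner_apply, inner_apply]
  simp only [hind]
  have h1 : ∑ g, spechtChar mu (n + 1) g⁻¹ * ((n.factorial : ℚ)⁻¹ *
      ∑ x : Equiv.Perm (Fin (n + 1)), ∑ k : Equiv.Perm (Fin n),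
        if incl n k = x * g * x⁻¹ then χ k else 0) =
      (n.factorial : ℚ)⁻¹ * ∑ x : Equiv.Perm (Fin (n + 1)), ∑ g, spechtChar mu (n + 1) g⁻¹ *
        ∑ k : Equiv.Perm (Fin n), if incl n k = x * g * x⁻¹ then χ k else 0 := by
    rw [Finset.sum_comm, Finset.mul_sum]
    refine Finset.sum_congr rfl fun g _ => ?_
    rw [← Finset.mul_sum]
    ring
  have h2 : ∀ x : Equiv.Perm (Fin (n + 1)), ∑ g, spechtChar mu (n + 1) g⁻¹ *
      (∑ k : Equiv.Perm (Fin n), if incl n k = x * g * x⁻¹ then χ k else 0) =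
        ∑ k, res n (spechtChar mu (n + 1)) k⁻¹ * χ k := by
    intro x
    rw [sum_conj_spechtChar mu (fun h => ∑ k : Equiv.Perm (Fin n),
      if incl n k = h then χ k else 0) x]
    simp only [Finset.mul_sum, mul_ite, mul_zero]
    rw [Finset.sum_comm]
    refine Finset.sum_congr rfl fun k _ => ?_
    rw [Finset.sum_ite_eq, if_pos (Finset.mem_univ _), ← map_inv]
    rfl
  rw [h1, Finset.sum_congr rfl fun x _ => h2 x, Finset.sum_const, Finset.card_univ,
    Fintype.card_perm, Fintype.card_fin, nsmul_eq_mul]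
  have : ((n + 1).factorial : ℚ) ≠ 0 := by exact_mod_cast (n + 1).factorial_ne_zero
  field_simp

end Branching

/-! ### The action of the restriction and induction functors -/

section Functors

variable {p n : ℕ} {ε : ZMod p} {la mu : YoungDiagram}

theorem blockComponent_apply (p n : ℕ) (C : Multiset (ZMod p)) (χ : Equiv.Perm (Fin n) → ℚ) :
    blockComponent p n C χ = ∑ la ∈ partitions n,
      open Classical in if content p la = C then inner n (spechtChar la n) χ • spechtChar la n
        else 0 := by
  classical
  rw [blockComponent, LinearMap.sum_apply, Finset.sum_filter]
  rfl

open Classical in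
theorem blockComponent_spechtChar (hmu : mu.card = n) (C : Multiset (ZMod p)) :
    blockComponent p n C (spechtChar mu n) =
      if content p mu = C then spechtChar mu n else 0 := by
  rw [blockComponent_apply, Finset.sum_eq_single mu]
  · rw [inner_spechtChar_self hmu, one_smul]
  · intro la hla hne
    rw [inner_spechtChar_of_ne (mem_partitions.1 hla) hmu hne, zero_smul, ite_self]
  · intro h
    exact absurd (mem_partitions.2 hmu) h

theorem content_card (p : ℕ) (la : YoungDiagram) : Multiset.card (content p la) = la.card := by
  simp [content]

theorem card_of_content (h : content p mu = ε ::ₘ content p la) : mu.card = la.card + 1 := by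
  rw [← content_card p, h, Multiset.card_cons, content_card]

theorem mem_contents (hla : la.card = n) : content p la ∈ contents p n :=
  Finset.mem_image_of_mem _ (mem_partitions.2 hla)

open Classical in
/-- The diagrams that arise by removing a cell of residue `ε`. -/
def lower (p : ℕ) (ε : ZMod p) (mu : YoungDiagram) : Finset YoungDiagram :=
  (partitions (mu.card - 1)).filter fun la => la ≤ mu ∧ content p mu = ε ::ₘ content p la

open Classical in
/-- The diagrams that arise by adding a cell of residue `ε`. -/
def upper (p : ℕ) (ε : ZMod p) (la : YoungDiagram) : Finset YoungDiagram :=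
  (partitions (la.card + 1)).filter fun mu => la ≤ mu ∧ content p mu = ε ::ₘ content p la

theorem mem_lower : la ∈ lower p ε mu ↔ la ≤ mu ∧ content p mu = ε ::ₘ content p la := by
  classical
  rw [lower, Finset.mem_filter, mem_partitions, and_iff_right_iff_imp]
  rintro ⟨-, h⟩
  have := card_of_content h
  omega

theorem mem_upper : mu ∈ upper p ε la ↔ la ≤ mu ∧ content p mu = ε ::ₘ content p la := by
  classical
  rw [upper, Finset.mem_filter, mem_partitions, and_iff_right_iff_imp]
  rintro ⟨-, h⟩
  exact card_of_content h

theorem sum_spechtChar_apply (s : Finset YoungDiagram) (n : ℕ) :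
    (∑ la ∈ s, spechtChar la) n = ∑ la ∈ s, spechtChar la n :=
  Finset.sum_apply _ _ _

theorem eFun_spechtChar (p : ℕ) (ε : ZMod p) (mu : YoungDiagram) :
    eFun p ε (spechtChar mu) = ∑ la ∈ lower p ε mu, spechtChar la := by
  classical
  funext n
  rw [sum_spechtChar_apply]
  change (∑ C ∈ contents p n, blockComponent p n C ∘ₗ res n ∘ₗ
    blockComponent p (n + 1) (ε ::ₘ C)) (spechtChar mu (n + 1)) = _
  rw [LinearMap.sum_apply]
  simp only [LinearMap.comp_apply]
  by_cases hmu : mu.card = n + 1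
  · have h1 : ∀ C ∈ contents p n,
        blockComponent p n C (res n (blockComponent p (n + 1) (ε ::ₘ C) (spechtChar mu (n + 1)))) =
          ∑ la ∈ (partitions n).filter (fun la => content p la = C),
            if la ≤ mu ∧ content p mu = ε ::ₘ content p la then spechtChar la n else 0 := by
      intro C _
      rw [blockComponent_spechtChar hmu, Finset.sum_filter]
      split_ifs with hC
      · rw [blockComponent_apply]
        refine Finset.sum_congr rfl fun la hla => ?_
        have hm : inner n (spechtChar la n) (res n (spechtChar mu (n + 1))) = _ :=
          mult_eq_contains (mem_partitions.1 hla) hmu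
        rw [hm, contains]
        by_cases h2 : content p la = C
        · by_cases h3 : la ≤ mu <;> simp [h2, h3, hC]
        · simp [h2]
      · rw [map_zero, map_zero, Finset.sum_eq_zero]
        intro la _
        by_cases h2 : content p la = C
        · simp [h2, hC]
        · simp [h2]
    -- Every partition of `n` has exactly one content, so the sum over blocks is a sum over all
    -- partitions.
    rw [Finset.sum_congr rfl h1, Finset.sum_fiberwise_of_maps_to
      fun la hla => mem_contents (mem_partitions.1 hla), ← Finset.sum_filter]
    refine Finset.sum_congr ?_ fun _ _ => rfl
    rw [lower, hmu]
    rfl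
  · rw [spechtChar_eq_zero hmu]
    simp only [map_zero, Finset.sum_const_zero]
    refine (Finset.sum_eq_zero fun la hla => spechtChar_eq_zero fun hc => hmu ?_).symm
    rw [card_of_content (mem_lower.1 hla).2, hc]

theorem fFun_spechtChar (p : ℕ) (ε : ZMod p) (la : YoungDiagram) :
    fFun p ε (spechtChar la) = ∑ mu ∈ upper p ε la, spechtChar mu := by
  classical
  funext m
  rw [sum_spechtChar_apply]
  cases m with
  | zero =>
    change (0 : (Equiv.Perm (Fin 0) → ℚ)) = _
    refine (Finset.sum_eq_zero fun mu hmu => spechtChar_eq_zero ?_).symm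
    rw [card_of_content (mem_upper.1 hmu).2]
    omega
  | succ n =>
    change (∑ C ∈ contents p n, blockComponent p (n + 1) (ε ::ₘ C) ∘ₗ ind n ∘ₗ
      blockComponent p n C) (spechtChar la n) = _
    rw [LinearMap.sum_apply]
    simp only [LinearMap.comp_apply]
    by_cases hla : la.card = n
    · rw [Finset.sum_eq_single (content p la)]
      · rw [blockComponent_spechtChar hla, if_pos rfl, blockComponent_apply, upper,
          Finset.sum_filter, hla]
        refine Finset.sum_congr rfl fun mu hmu => ?_
        have hm : inner n (spechtChar la n) (res n (spechtChar mu (n + 1))) = _ :=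
          mult_eq_contains hla (mem_partitions.1 hmu)
        rw [inner_ind, inner_comm, hm, contains]
        by_cases h2 : content p mu = ε ::ₘ content p la
        · by_cases h3 : la ≤ mu <;> simp [h2, h3]
        · simp [h2]
      · intro C _ hC
        rw [blockComponent_spechtChar hla, if_neg hC.symm, map_zero, map_zero]
      · intro h
        exact absurd (mem_contents hla) h
    · rw [spechtChar_eq_zero hla]
      simp only [map_zero, Finset.sum_const_zero]
      refine (Finset.sum_eq_zero fun mu hmu => spechtChar_eq_zero fun hc => hla ?_).symm
      rw [card_of_content (mem_upper.1 hmu).2] at hc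
      omega

end Functors

/-! ### Runner swapping on a Boolean lattice -/

section Boolean

theorem divPow_apply (T : Module.End ℚ ClassFun) (k : ℕ) (χ : ClassFun) :
    divPow T k χ = (k.factorial : ℚ)⁻¹ • (T ^ k) χ := rfl

/-- Divided powers of an operator that removes elements from sets. -/
theorem divPow_remove {T : Module.End ℚ ClassFun} {U : Finset ℕ} {v : Finset ℕ → ClassFun}
    (hT : ∀ X ⊆ U, T (v X) = ∑ k ∈ X, v (X.erase k)) {X : Finset ℕ} (hX : X ⊆ U) (m : ℕ) :
    divPow T m (v X) = ∑ Y ∈ X.powerset.filter (fun Y => Y.card + m = X.card), v Y := by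
  suffices h : (T ^ m) (v X) = (m.factorial : ℚ) •
      ∑ Y ∈ X.powerset.filter (fun Y => Y.card + m = X.card), v Y by
    rw [divPow_apply, h, smul_smul, inv_mul_cancel₀ (by exact_mod_cast m.factorial_ne_zero),
      one_smul]
  induction m with
  | zero =>
    have : X.powerset.filter (fun Y => Y.card + 0 = X.card) = {X} := by
      ext Y
      rw [Finset.mem_filter, Finset.mem_powerset, Finset.mem_singleton]
      constructor
      · rintro ⟨h1, h2⟩
        exact Finset.eq_of_subset_of_card_le h1 (by omega)
      · rintro rfl
        simp
    rw [this]
    simp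
  | succ m ih =>
    rw [pow_succ', Module.End.mul_apply, ih, map_smul, map_sum]
    -- Pairs of `Y` and `k ∈ Y` correspond to pairs of `Z = Y \ {k}` and `k ∈ X \ Z`, so each `Z` is
    -- counted `m + 1` times.
    have h1 : ∑ Y ∈ X.powerset.filter (fun Y => Y.card + m = X.card), T (v Y) =
        ∑ Z ∈ X.powerset.filter (fun Z => Z.card + (m + 1) = X.card), ∑ k ∈ X \ Z, v Z := by
      rw [Finset.sum_congr rfl fun Y hY => hT Y
        ((Finset.mem_powerset.1 (Finset.mem_filter.1 hY).1).trans hX),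
        Finset.sum_sigma', Finset.sum_sigma']
      refine Finset.sum_bij' (fun q _ => ⟨q.1.erase q.2, q.2⟩) (fun q _ => ⟨insert q.2 q.1, q.2⟩)
        ?_ ?_ ?_ ?_ ?_
      · rintro ⟨Y, k⟩ h
        simp only [Finset.mem_sigma, Finset.mem_filter, Finset.mem_powerset,
          Finset.mem_sdiff] at h ⊢
        obtain ⟨⟨h1, h2⟩, h3⟩ := h
        have := Finset.card_erase_add_one h3
        exact ⟨⟨(Finset.erase_subset _ _).trans h1, by omega⟩, h1 h3, Finset.notMem_erase _ _⟩
      · rintro ⟨Z, k⟩ h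
        simp only [Finset.mem_sigma, Finset.mem_filter, Finset.mem_powerset,
          Finset.mem_sdiff] at h ⊢
        obtain ⟨⟨h1, h2⟩, h3, h4⟩ := h
        rw [Finset.card_insert_of_notMem h4]
        exact ⟨⟨Finset.insert_subset h3 h1, by omega⟩, Finset.mem_insert_self _ _⟩
      · rintro ⟨Y, k⟩ h
        simp only [Finset.mem_sigma] at h
        simp [Finset.insert_erase h.2]
      · rintro ⟨Z, k⟩ h
        simp only [Finset.mem_sigma, Finset.mem_sdiff] at h
        simp [Finset.erase_insert h.2.2]
      · rintro ⟨Y, k⟩ _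
        rfl
    rw [h1, Nat.factorial_succ, Nat.cast_mul, mul_comm ((m + 1 : ℕ) : ℚ), mul_smul]
    congr 1
    rw [Finset.smul_sum]
    refine Finset.sum_congr rfl fun Z hZ => ?_
    rw [Finset.mem_filter, Finset.mem_powerset] at hZ
    rw [Finset.sum_const, Finset.card_sdiff_of_subset hZ.1, Nat.cast_smul_eq_nsmul]
    congr 1
    omega

/-- Divided powers of an operator that adds elements to sets. -/
theorem divPow_insert {T : Module.End ℚ ClassFun} {U : Finset ℕ} {v : Finset ℕ → ClassFun}
    (hT : ∀ X ⊆ U, T (v X) = ∑ k ∈ U \ X, v (insert k X)) {X : Finset ℕ} (hX : X ⊆ U) (m : ℕ) :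
    divPow T m (v X) =
      ∑ W ∈ (U \ X).powerset.filter (fun W => W.card + m = (U \ X).card), v (U \ W) := by
  -- Adding elements to `X` is removing them from its complement in `U`.
  have h := divPow_remove (T := T) (U := U) (v := fun W => v (U \ W)) ?_
    (Finset.sdiff_subset (s := U) (t := X)) m
  · simpa only [Finset.sdiff_sdiff_eq_self hX] using h
  · intro W hW
    rw [hT _ Finset.sdiff_subset, Finset.sdiff_sdiff_eq_self hW]
    refine Finset.sum_congr rfl fun k hk => ?_
    rw [Finset.sdiff_erase (hW hk)]

/-- The subsets of `X` disjoint from `W` are those of `X \ W`, and their alternating sum vanishes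
unless `X \ W` is empty. -/
theorem sum_powerset_neg_one (U X W : Finset ℕ) :
    ∑ Y ∈ X.powerset.filter (fun Y => Disjoint W Y), (-1 : ℚ) ^ (U.card + Y.card) =
      if X ⊆ W then (-1) ^ U.card else 0 := by
  have h1 : X.powerset.filter (fun Y => Disjoint W Y) = (X \ W).powerset := by
    ext Y
    rw [Finset.mem_filter, Finset.mem_powerset, Finset.mem_powerset, Finset.subset_sdiff,
      disjoint_comm]
  have h2 := Finset.sum_powerset_neg_one_pow_card (x := X \ W)
  have h3 : ∑ Y ∈ (X \ W).powerset, (-1 : ℚ) ^ Y.card = if X \ W = ∅ then 1 else 0 := by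
    exact_mod_cast h2
  simp only [h1, pow_add, ← Finset.mul_sum, h3, Finset.sdiff_eq_empty_iff_subset]
  split_ifs <;> simp

/-- If `e_ε` removes and `f_ε` adds elements of subsets of `U`, then the runner-swapping function
replaces a subset by its complement, up to a sign. -/
theorem runnerSwap_boolean {p : ℕ} {ε : ZMod p} {U : Finset ℕ} {v : Finset ℕ → ClassFun}
    (he : ∀ X ⊆ U, eFun p ε (v X) = ∑ k ∈ X, v (X.erase k))
    (hf : ∀ X ⊆ U, fFun p ε (v X) = ∑ k ∈ U \ X, v (insert k X))
    {X : Finset ℕ} (hX : X ⊆ U) {c : ℤ} (hc : c = ((U \ X).card : ℤ) - X.card) :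
    runnerSwap p ε c (v X) = (-1 : ℚ) ^ (U \ X).card • v (U \ X) := by
  have hUX : (U \ X).card + X.card = U.card := Finset.card_sdiff_add_card_eq_card hX
  -- Here `W` is the complement of the set reached from `Y`. That set has `|X| + c = |U \ X|`
  -- elements, so `|W| = |X|` for every `a`.
  have hterm : ∀ a : ℕ, (if -c ≤ (a : ℤ) then (-1 : ℚ) ^ (a + c).toNat •
      divPow (fFun p ε) (a + c).toNat (divPow (eFun p ε) a (v X)) else 0) =
      ∑ Y ∈ X.powerset.filter (fun Y => Y.card + a = X.card),
        ∑ W ∈ U.powerset.filter (fun W => W.card = X.card),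
          if Disjoint W Y then (-1 : ℚ) ^ ((U \ X).card + Y.card) • v (U \ W) else 0 := by
    intro a
    have key : ∀ Y ∈ X.powerset.filter (fun Y => Y.card + a = X.card),
        ∑ W ∈ U.powerset.filter (fun W => W.card = X.card),
          (if Disjoint W Y then (-1 : ℚ) ^ ((U \ X).card + Y.card) • v (U \ W) else 0) =
        if -c ≤ (a : ℤ) then (-1 : ℚ) ^ (a + c).toNat •
          divPow (fFun p ε) (a + c).toNat (v Y) else 0 := by
      intro Y hY
      rw [Finset.mem_filter, Finset.mem_powerset] at hY
      obtain ⟨hYX, hYa⟩ := hY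
      have hUY : (U \ Y).card + Y.card = U.card :=
        Finset.card_sdiff_add_card_eq_card (hYX.trans hX)
      rw [← Finset.sum_filter, Finset.filter_filter, ← Finset.smul_sum]
      split_ifs with hca
      · have hsign : (-1 : ℚ) ^ ((U \ X).card + Y.card) = (-1) ^ (a + c).toNat := by
          -- Since `a = |X| - |Y|`, the exponent `a + c` is `|U \ X| - |Y|`.
          have : (U \ X).card + Y.card = (a + c).toNat + 2 * Y.card := by omega
          rw [this, pow_add, pow_mul]
          simp
        rw [hsign, divPow_insert hf (hYX.trans hX)]
        congr 1
        refine Finset.sum_congr ?_ fun _ _ => rfl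
        ext W
        simp only [Finset.mem_filter, Finset.mem_powerset, Finset.subset_sdiff]
        constructor
        · rintro ⟨h1, h2, h3⟩
          exact ⟨⟨h1, h3⟩, by omega⟩
        · rintro ⟨⟨h1, h3⟩, h2⟩
          exact ⟨h1, by omega, h3⟩
      -- If `a + c < 0`, then `U \ Y` has `|U \ X| + a < |X|` elements, too few to contain `W`.
      · rw [Finset.filter_eq_empty_iff.2, Finset.sum_empty, smul_zero]
        rintro W hW ⟨h1, h2⟩
        have h3 : W ⊆ U \ Y := Finset.subset_sdiff.2 ⟨Finset.mem_powerset.1 hW, h2⟩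
        have := Finset.card_le_card h3
        omega
    rw [Finset.sum_congr rfl key, divPow_remove he hX]
    split_ifs
    · rw [map_sum, Finset.smul_sum]
    · simp
  -- No `Y ⊆ X` has `|Y| + a = |X|` once `a > |X|`, so the sum is finite.
  have hfin : ∀ n, runnerSwap p ε c (v X) n = (∑ a ∈ Finset.range (X.card + 1),
      ∑ Y ∈ X.powerset.filter (fun Y => Y.card + a = X.card),
        ∑ W ∈ U.powerset.filter (fun W => W.card = X.card),
          if Disjoint W Y then (-1 : ℚ) ^ ((U \ X).card + Y.card) • v (U \ W) else 0) n := by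
    intro n
    rw [runnerSwap, finsum_eq_sum_of_support_subset (s := Finset.range (X.card + 1)),
      Finset.sum_apply]
    · refine Finset.sum_congr rfl fun a _ => ?_
      rw [finsum_eq_if, ← hterm a]
      split_ifs <;> rfl
    · intro a ha
      rw [Finset.mem_coe, Finset.mem_range]
      by_contra hlt
      refine ha ?_
      have h0 := congrFun (hterm a) n
      rw [Finset.filter_eq_empty_iff.2 (fun Y hY => by omega), Finset.sum_empty] at h0
      simp only
      rw [finsum_eq_if]
      refine Eq.trans ?_ h0
      split_ifs <;> rfl
  funext n
  rw [hfin n]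
  refine congrFun ?_ n
  have hfib : ∀ F : Finset ℕ → ClassFun, ∑ a ∈ Finset.range (X.card + 1),
      ∑ Y ∈ X.powerset.filter (fun Y => Y.card + a = X.card), F Y = ∑ Y ∈ X.powerset, F Y := by
    intro F
    rw [← Finset.sum_fiberwise_of_maps_to (s := X.powerset) (t := Finset.range (X.card + 1))
      (g := fun Y => X.card - Y.card) (fun Y _ => by rw [Finset.mem_range]; omega)]
    refine Finset.sum_congr rfl fun a _ => Finset.sum_congr ?_ fun _ _ => rfl
    refine Finset.filter_congr fun Y hY => ?_
    have := Finset.card_le_card (Finset.mem_powerset.1 hY)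
    rw [Finset.mem_range] at *
    omega
  -- For fixed `W` the alternating sum over `Y` vanishes unless `X ⊆ W`, and the sizes then give `W
  -- = X`.
  rw [hfib, Finset.sum_comm, Finset.sum_eq_single X]
  · rw [← Finset.sum_filter, ← Finset.sum_smul, sum_powerset_neg_one, if_pos subset_rfl]
  · intro W hW hne
    rw [Finset.mem_filter] at hW
    rw [← Finset.sum_filter, ← Finset.sum_smul, sum_powerset_neg_one, if_neg, zero_smul]
    exact fun h => hne (Finset.eq_of_subset_of_card_le h hW.2.le).symm
  · intro h
    exact (h (Finset.mem_filter.2 ⟨Finset.mem_powerset.2 hX, rfl⟩)).elim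

end Boolean

/-! ### Abacus displays -/

section Abacus

variable {la mu nu : YoungDiagram} {r : ℕ} {B : Finset ℕ}

theorem IsAbacusDisplay.mem_iff (h : IsAbacusDisplay la r B) {x : ℕ} :
    x ∈ B ↔ ∃ j < r, la.rowLen j + (r - 1 - j) = x := by
  rw [h.2, Finset.mem_image]
  simp only [Finset.mem_range]

theorem bead_lt {j k : ℕ} (hjk : j < k) (hk : k < r) :
    la.rowLen k + (r - 1 - k) < la.rowLen j + (r - 1 - j) := by
  have := la.rowLen_anti j k hjk.le
  omega

theorem bead_injOn (la : YoungDiagram) (r : ℕ) :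
    Set.InjOn (fun j => la.rowLen j + (r - 1 - j)) (Finset.range r) := by
  intro j hj k hk h
  rw [Finset.mem_coe, Finset.mem_range] at hj hk
  simp only at h
  rcases lt_trichotomy j k with hlt | heq | hlt
  · have := bead_lt (la := la) hlt hk; omega
  · exact heq
  · have := bead_lt (la := la) hlt hj; omega

theorem IsAbacusDisplay.card (h : IsAbacusDisplay la r B) : B.card = r := by
  rw [h.2, Finset.card_image_of_injOn (bead_injOn la r), Finset.card_range]

theorem IsAbacusDisplay.card_filter_lt (h : IsAbacusDisplay la r B) {j : ℕ} (hj : j < r) :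
    (B.filter (la.rowLen j + (r - 1 - j) < ·)).card = j := by
  have : B.filter (la.rowLen j + (r - 1 - j) < ·) =
      (Finset.range j).image fun k => la.rowLen k + (r - 1 - k) := by
    ext x
    rw [Finset.mem_filter, h.mem_iff, Finset.mem_image]
    constructor
    · rintro ⟨⟨k, hk, rfl⟩, hlt⟩
      refine ⟨k, Finset.mem_range.2 ?_, rfl⟩
      by_contra hjk
      rcases (not_lt.1 hjk).eq_or_lt with rfl | hjk
      · omega
      · have := bead_lt (la := la) hjk hk; omega
    · rintro ⟨k, hk, rfl⟩
      rw [Finset.mem_range] at hk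
      exact ⟨⟨k, by omega, rfl⟩, bead_lt hk hj⟩
  rw [this, Finset.card_image_of_injOn, Finset.card_range]
  exact (bead_injOn la r).mono fun k hk => by
    rw [Finset.mem_coe, Finset.mem_range] at *; omega

theorem rowLen_eq_zero_of_colLen_le {j : ℕ} (h : la.colLen 0 ≤ j) : la.rowLen j = 0 := by
  by_contra hne
  have h1 : (j, 0) ∈ la := YoungDiagram.mem_iff_lt_rowLen.2 (by omega)
  rw [YoungDiagram.mem_iff_lt_colLen] at h1
  omega

theorem colLen_le_of_rowLen_eq_zero {j : ℕ} (h : la.rowLen j = 0) : la.colLen 0 ≤ j := by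
  by_contra hlt
  have h1 : (j, 0) ∈ la := YoungDiagram.mem_iff_lt_colLen.2 (by omega)
  rw [YoungDiagram.mem_iff_lt_rowLen] at h1
  omega

/-- The row of a bead is the number of beads at larger positions, so the bead set determines all row
lengths. -/
theorem IsAbacusDisplay.unique (h : IsAbacusDisplay la r B) (h' : IsAbacusDisplay mu r B) :
    la = mu := by
  refine eq_of_rowLen_eq fun j => ?_
  rcases lt_or_ge j r with hj | hj
  · obtain ⟨k, hk, hkj⟩ := h'.mem_iff.1 (h.mem_iff.2 ⟨j, hj, rfl⟩)
    have h1 := h.card_filter_lt hj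
    rw [← hkj, h'.card_filter_lt hk] at h1
    subst h1
    omega
  · rw [rowLen_eq_zero_of_colLen_le (h.1.trans hj), rowLen_eq_zero_of_colLen_le (h'.1.trans hj)]

/-- Position `0` can only hold the bead of row `r - 1`, and does so when that row is empty. -/
theorem IsAbacusDisplay.zero_mem_iff (h : IsAbacusDisplay la r B) : 0 ∈ B ↔ la.colLen 0 < r := by
  rw [h.mem_iff]
  constructor
  · rintro ⟨j, hj, h0⟩
    have := colLen_le_of_rowLen_eq_zero (la := la) (j := j) (by omega)
    omega
  · intro hlt
    refine ⟨r - 1, by omega, ?_⟩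
    rw [rowLen_eq_zero_of_colLen_le (by omega)]
    omega

/-- Adding a cell moves a bead to the next position. -/
theorem IsAbacusDisplay.addsCell (h : IsAbacusDisplay la r B) {j : ℕ} (hj : j < r)
    (hadd : AddsCell la j mu) {x : ℕ} (hx : la.rowLen j + (r - 1 - j) = x) :
    x ∈ B ∧ x + 1 ∉ B ∧ IsAbacusDisplay mu r (insert (x + 1) (B.erase x)) := by
  have hxB : x ∈ B := h.mem_iff.2 ⟨j, hj, hx⟩
  have hmu : mu.colLen 0 ≤ r := by
    refine colLen_le_of_rowLen_eq_zero ?_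
    rw [hadd.rowLen, rowLen_eq_zero_of_colLen_le h.1, if_neg hj.ne']
  refine ⟨hxB, fun hx1 => ?_, hmu, ?_⟩
  · obtain ⟨k, hk, hkx⟩ := h.mem_iff.1 hx1
    rcases lt_trichotomy k j with hlt | rfl | hlt
    · have := hadd.lt_rowLen hlt
      omega
    · omega
    · have := bead_lt (la := la) hlt hk
      omega
  · ext y
    rw [Finset.mem_insert, Finset.mem_erase, h.mem_iff, Finset.mem_image]
    simp only [hadd.rowLen, Finset.mem_range]
    constructor
    · rintro (rfl | ⟨hne, k, hk, rfl⟩)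
      · exact ⟨j, hj, by rw [if_pos rfl]; omega⟩
      · refine ⟨k, hk, ?_⟩
        rw [if_neg]
        · omega
        · rintro rfl; exact hne hx
    · rintro ⟨k, hk, rfl⟩
      by_cases hkj : k = j
      · subst hkj
        left; rw [if_pos rfl]; omega
      · right
        rw [if_neg hkj]
        refine ⟨fun he => hkj ?_, k, hk, by omega⟩
        exact bead_injOn la r (by simpa using hk) (by simpa using hj) (by simp only; omega)

theorem IsAbacusDisplay.exists_move (h : IsAbacusDisplay la r B) {x : ℕ} (hx : x ∈ B)
    (hx1 : x + 1 ∉ B) : ∃ mu j, AddsCell la j mu ∧ j < r ∧ la.rowLen j + (r - 1 - j) = x ∧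
      IsAbacusDisplay mu r (insert (x + 1) (B.erase x)) := by
  obtain ⟨j, hj, hjx⟩ := h.mem_iff.1 hx
  have hadd : ∀ k < j, la.rowLen j < la.rowLen k := by
    intro k hk
    -- Equal lengths would put the bead of row `j - 1` at `x + 1`.
    have h1 : la.rowLen j ≠ la.rowLen (j - 1) := by
      intro he
      exact hx1 (h.mem_iff.2 ⟨j - 1, by omega, by omega⟩)
    have h2 := la.rowLen_anti (j - 1) j (by omega)
    have h3 := la.rowLen_anti k (j - 1) (by omega)
    omega
  obtain ⟨mu, hmu⟩ := exists_addsCell hadd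
  exact ⟨mu, j, hmu, hj, hjx, (h.addsCell hj hmu hjx).2.2⟩

theorem isAbacusDisplay_bot (r : ℕ) : IsAbacusDisplay ⊥ r (Finset.range r) := by
  have h0 : ∀ j, (⊥ : YoungDiagram).rowLen j = 0 := fun j =>
    rowLen_eq_of_forall_mem fun k => by simp
  refine ⟨colLen_le_of_rowLen_eq_zero (h0 r), ?_⟩
  ext x
  simp only [h0, Finset.mem_range, Finset.mem_image]
  constructor
  · intro hx
    exact ⟨r - 1 - x, by omega, by omega⟩
  · rintro ⟨j, hj, rfl⟩
    omega

theorem eq_range_of_pred_mem (h : ∀ x, x + 1 ∈ B → x ∈ B) : B = Finset.range B.card := by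
  have hdown : ∀ d x, x + d ∈ B → x ∈ B := by
    intro d
    induction d with
    | zero => exact fun x hx => hx
    | succ d ih => exact fun x hx => ih x (h _ hx)
  refine Finset.eq_of_subset_of_card_le (fun x hx => ?_) (by simp)
  have : Finset.range (x + 1) ⊆ B := fun y hy => by
    rw [Finset.mem_range] at hy
    exact hdown (x - y) y (by rwa [Nat.add_sub_cancel' (by omega)])
  have := Finset.card_le_card this
  rw [Finset.card_range] at this
  exact Finset.mem_range.2 this

/-- Induction on the sum of the positions: a bead with a vacancy just before it is moved back. If
there is none, the beads fill an initial segment, which displays the empty partition. -/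
theorem exists_isAbacusDisplay (B : Finset ℕ) : ∃ la, IsAbacusDisplay la B.card B := by
  induction hs : ∑ x ∈ B, x using Nat.strong_induction_on generalizing B with
  | _ s ih =>
    by_cases hdown : ∀ x, x + 1 ∈ B → x ∈ B
    · refine ⟨⊥, ?_⟩
      have := isAbacusDisplay_bot B.card
      rwa [← eq_range_of_pred_mem hdown] at this
    · push Not at hdown
      obtain ⟨x, hx1, hx⟩ := hdown
      have hxe : x ∉ B.erase (x + 1) := fun h => hx (Finset.mem_of_mem_erase h)
      have hsum : ∑ y ∈ insert x (B.erase (x + 1)), y < s := by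
        rw [Finset.sum_insert hxe, ← hs, ← Finset.add_sum_erase B (fun y => y) hx1]
        omega
      have hcard : (insert x (B.erase (x + 1))).card = B.card := by
        rw [Finset.card_insert_of_notMem hxe, Finset.card_erase_add_one hx1]
      obtain ⟨la, hla⟩ := ih _ hsum _ rfl
      obtain ⟨mu, -, -, -, -, hmu⟩ := hla.exists_move (Finset.mem_insert_self _ _)
        (by simp)
      refine ⟨mu, ?_⟩
      rw [hcard, Finset.erase_insert hxe, Finset.insert_erase hx1] at hmu
      exact hmu

/-! ### Residues -/

variable {p : ℕ} {ε : ZMod p}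

theorem AddsCell.content {j : ℕ} (h : AddsCell la j mu) :
    content p mu = ((la.rowLen j : ZMod p) - (j : ZMod p)) ::ₘ content p la := by
  rw [RunnerSwap.content, h, Finset.insert_val_of_notMem (AddsCell.notMem la j), Multiset.map_cons]
  rfl

theorem AddsCell.content_eq_iff {j : ℕ} (h : AddsCell la j mu) :
    RunnerSwap.content p mu = ε ::ₘ RunnerSwap.content p la ↔
      (la.rowLen j : ZMod p) - (j : ZMod p) = ε := by
  rw [h.content, Multiset.cons_inj_left]

theorem bead_residue {j x l : ℕ} (hj : j < r) (hx : l + (r - 1 - j) = x) :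
    (l : ZMod p) - (j : ZMod p) = ((x + 1 : ℕ) : ZMod p) - (r : ZMod p) := by
  have h : x + 1 + j = l + r := by omega
  have h' : ((x + 1 : ℕ) : ZMod p) + j = l + r := by exact_mod_cast congrArg (Nat.cast (R := ZMod p)) h
  linear_combination -h'

theorem mem_lower_iff (h : IsAbacusDisplay la r B) {i : ℕ}
    (hε : ε = (i : ZMod p) - (r : ZMod p)) :
    nu ∈ lower p ε la ↔ ∃ x, x + 1 ∈ B ∧ x ∉ B ∧ ((x + 1 : ℕ) : ZMod p) = i ∧
      IsAbacusDisplay nu r (insert x (B.erase (x + 1))) := by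
  rw [mem_lower]
  constructor
  · rintro ⟨hle, hcon⟩
    obtain ⟨j, hj⟩ := exists_addsCell_iff.2 ⟨hle, card_of_content hcon⟩
    have hjr : j < r := by
      by_contra hlt
      have h1 := hj.rowLen j
      rw [if_pos rfl, rowLen_eq_zero_of_colLen_le (by have := h.1; omega)] at h1
      omega
    have hnu : nu.colLen 0 ≤ r := by
      refine colLen_le_of_rowLen_eq_zero ?_
      have h1 := hj.rowLen r
      rw [rowLen_eq_zero_of_colLen_le h.1] at h1
      omega
    have hd : IsAbacusDisplay nu r _ := ⟨hnu, rfl⟩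
    obtain ⟨h1, h2, h3⟩ := hd.addsCell hjr hj rfl
    have hB : B = _ := h.2.trans h3.2.symm
    rw [hj.content_eq_iff, hε, bead_residue hjr rfl, sub_left_inj] at hcon
    refine ⟨_, ?_, ?_, hcon, ?_⟩
    · rw [hB]; exact Finset.mem_insert_self _ _
    · rw [hB]; simp
    · rw [hB, Finset.erase_insert (fun hm => h2 (Finset.mem_of_mem_erase hm)),
        Finset.insert_erase h1]
      exact hd
  · rintro ⟨x, hx1, hx, hres, hd⟩
    have hxe : x ∉ B.erase (x + 1) := fun h => hx (Finset.mem_of_mem_erase h)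
    obtain ⟨mu, j, hadd, hjr, hjx, hmu⟩ := hd.exists_move (Finset.mem_insert_self _ _) (by simp)
    rw [Finset.erase_insert hxe, Finset.insert_erase hx1] at hmu
    obtain rfl := hmu.unique h
    exact ⟨hadd.le, hadd.content_eq_iff.2 (by rw [bead_residue hjr hjx, hres, hε])⟩

/-- A cell added in row `r` moves none of the `r` beads. Its residue is `-r`, which equals `ε` only
for `i = p`; a bead at `0` then makes row `r - 1` empty, so row `r` is not addable. -/
theorem mem_upper_iff (h : IsAbacusDisplay la r B) {i : ℕ} (hi : 1 ≤ i) (hip : i ≤ p)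
    (hlast : i = p → 0 ∈ B) (hε : ε = (i : ZMod p) - (r : ZMod p)) :
    mu ∈ upper p ε la ↔ ∃ x, x ∈ B ∧ x + 1 ∉ B ∧ ((x + 1 : ℕ) : ZMod p) = i ∧
      IsAbacusDisplay mu r (insert (x + 1) (B.erase x)) := by
  rw [mem_upper]
  constructor
  · rintro ⟨hle, hcon⟩
    obtain ⟨j, hj⟩ := exists_addsCell_iff.2 ⟨hle, card_of_content hcon⟩
    rw [hj.content_eq_iff, hε] at hcon
    have hjr : j < r := by
      by_contra hlt
      have h0 : la.rowLen j = 0 := rowLen_eq_zero_of_colLen_le (by have := h.1; omega)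
      have hcol : ¬ la.colLen 0 < j := fun hc => by
        have := hj.lt_rowLen hc
        rw [rowLen_eq_zero_of_colLen_le le_rfl] at this
        omega
      have hjr : j = r := by have := h.1; omega
      rw [h0, hjr, sub_left_inj, Nat.cast_zero, eq_comm, ZMod.natCast_eq_zero_iff] at hcon
      have := h.zero_mem_iff.1 (hlast (le_antisymm hip (Nat.le_of_dvd hi hcon)))
      omega
    obtain ⟨h1, h2, h3⟩ := h.addsCell hjr hj rfl
    rw [bead_residue hjr rfl, sub_left_inj] at hcon
    exact ⟨_, h1, h2, hcon, h3⟩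
  · rintro ⟨x, hx, hx1, hres, hd⟩
    obtain ⟨nu, j, hadd, hjr, hjx, hnu⟩ := h.exists_move hx hx1
    obtain rfl := hnu.unique hd
    exact ⟨hadd.le, hadd.content_eq_iff.2 (by rw [bead_residue hjr hjx, hres, hε])⟩

/-- As `x + 1` is positive and `i ≤ p`, the congruence forces `i ≤ x + 1`. For `i = p` this leaves
out position `0`, in line with the convention for runner `p`. -/
theorem natCast_eq_iff_onRunner {i : ℕ} (hip : i ≤ p) (x : ℕ) :
    ((x + 1 : ℕ) : ZMod p) = i ↔ ∃ k, x + 1 = i + k * p := by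
  constructor
  · intro h
    rw [ZMod.natCast_eq_natCast_iff] at h
    rcases le_or_gt i (x + 1) with hle | hlt
    · obtain ⟨k, hk⟩ := (Nat.modEq_iff_dvd' hle).1 h.symm
      exact ⟨k, by rw [mul_comm]; omega⟩
    · obtain ⟨k, hk⟩ := (Nat.modEq_iff_dvd' hlt.le).1 h
      have : k ≠ 0 := by rintro rfl; omega
      have := Nat.le_mul_of_pos_right p (Nat.pos_of_ne_zero this)
      omega
  · rintro ⟨k, hk⟩
    rw [hk]
    simp

end Abacus

/-! ### The bead configurations between a display and its swap -/

section Family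

/-- The configuration that agrees with `B` except that, for `k ∈ U`, there is exactly one bead in
the positions `L k` and `L k + 1`, which is in the second position if and only if `k ∈ X`. -/
def beadFamily (L : ℕ → ℕ) (B U X : Finset ℕ) : Finset ℕ :=
  (B \ (U.image L ∪ U.image (L · + 1))) ∪ (X.image (L · + 1) ∪ (U \ X).image L)

variable {L : ℕ → ℕ} {B U X Y : Finset ℕ}

theorem mem_beadFamily {y : ℕ} : y ∈ beadFamily L B U X ↔
    (y ∈ B ∧ ∀ k ∈ U, L k ≠ y ∧ L k + 1 ≠ y) ∨ (∃ k ∈ X, L k + 1 = y) ∨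
      ∃ k ∈ U, k ∉ X ∧ L k = y := by
  simp only [beadFamily, Finset.mem_union, Finset.mem_sdiff, Finset.mem_image, not_or, not_exists,
    not_and]
  constructor
  · rintro (⟨h1, h2, h3⟩ | h | ⟨k, hk, h⟩)
    · exact Or.inl ⟨h1, fun k hk => ⟨h2 k hk, h3 k hk⟩⟩
    · exact Or.inr (Or.inl h)
    · exact Or.inr (Or.inr ⟨k, hk.1, hk.2, h⟩)
  · rintro (⟨h1, h2⟩ | h | ⟨k, hk, hk', h⟩)
    · exact Or.inl ⟨h1, fun k hk => (h2 k hk).1, fun k hk => (h2 k hk).2⟩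
    · exact Or.inr (Or.inl h)
    · exact Or.inr (Or.inr ⟨k, ⟨hk, hk'⟩, h⟩)

theorem mem_beadFamily_succ (hL : Function.Injective L) (hne : ∀ k l, L k ≠ L l + 1)
    (hX : X ⊆ U) (k : ℕ) :
    L k + 1 ∈ beadFamily L B U X ↔ if k ∈ U then k ∈ X else L k + 1 ∈ B := by
  rw [mem_beadFamily]
  have h1 : (∃ l ∈ X, L l + 1 = L k + 1) ↔ k ∈ X := by
    constructor
    · rintro ⟨l, hl, h⟩
      rwa [← hL (Nat.succ_injective h)]
    · exact fun h => ⟨k, h, rfl⟩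
  have h2 : ¬ ∃ l ∈ U, l ∉ X ∧ L l = L k + 1 := by
    rintro ⟨l, -, -, h⟩
    exact hne l k h
  rw [h1, or_iff_left h2]
  split_ifs with hk
  · exact or_iff_right fun h => (h.2 k hk).2 rfl
  · rw [or_iff_left fun h => hk (hX h), and_iff_left_iff_imp]
    exact fun _ l hl => ⟨hne l k, fun h => hk (hL (Nat.succ_injective h) ▸ hl)⟩

theorem mem_beadFamily_self (hL : Function.Injective L) (hne : ∀ k l, L k ≠ L l + 1) (k : ℕ) :
    L k ∈ beadFamily L B U X ↔ if k ∈ U then k ∉ X else L k ∈ B := by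
  rw [mem_beadFamily]
  have h1 : (∃ l ∈ U, l ∉ X ∧ L l = L k) ↔ k ∈ U ∧ k ∉ X := by
    constructor
    · rintro ⟨l, hl, hl', h⟩
      rw [← hL h]
      exact ⟨hl, hl'⟩
    · exact fun h => ⟨k, h.1, h.2, rfl⟩
  have h2 : ¬ ∃ l ∈ X, L l + 1 = L k := by
    rintro ⟨l, -, h⟩
    exact hne k l h.symm
  rw [h1, or_iff_right h2]
  split_ifs with hk
  · rw [or_iff_right fun h => (h.2 k hk).1 rfl, and_iff_right hk]
  · rw [or_iff_left fun h => hk h.1, and_iff_left_iff_imp]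
    exact fun _ l hl => ⟨fun h => hk (hL h ▸ hl), fun h => hne k l h.symm⟩

theorem mem_beadFamily_of_ne {y : ℕ} (hy : ∀ k, L k ≠ y ∧ L k + 1 ≠ y) :
    y ∈ beadFamily L B U X ↔ y ∈ B := by
  rw [mem_beadFamily, or_iff_left, and_iff_left fun k _ => hy k]
  rintro (⟨k, -, h⟩ | ⟨k, -, -, h⟩)
  · exact (hy k).2 h
  · exact (hy k).1 h

/-- Two finite sets agree if they agree on the runners and off the runners. -/
theorem ext_runners {C D : Finset ℕ} (h1 : ∀ k, L k ∈ C ↔ L k ∈ D)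
    (h2 : ∀ k, L k + 1 ∈ C ↔ L k + 1 ∈ D)
    (h3 : ∀ y, (∀ k, L k ≠ y ∧ L k + 1 ≠ y) → (y ∈ C ↔ y ∈ D)) : C = D := by
  ext y
  by_cases hy : ∀ k, L k ≠ y ∧ L k + 1 ≠ y
  · exact h3 y hy
  · push Not at hy
    obtain ⟨k, hk⟩ := hy
    by_cases h : L k = y
    · rw [← h]; exact h1 k
    · rw [← hk h]; exact h2 k

theorem beadFamily_erase (hL : Function.Injective L) (hne : ∀ k l, L k ≠ L l + 1)
    (hX : X ⊆ U) {k : ℕ} (hk : k ∈ X) :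
    insert (L k) ((beadFamily L B U X).erase (L k + 1)) = beadFamily L B U (X.erase k) := by
  have hX' : X.erase k ⊆ U := (Finset.erase_subset _ _).trans hX
  refine ext_runners (L := L) (fun l => ?_) (fun l => ?_) fun y hy => ?_
  · rw [Finset.mem_insert, Finset.mem_erase, mem_beadFamily_self hL hne,
      mem_beadFamily_self hL hne, hL.eq_iff, and_iff_right (hne l k), Finset.mem_erase]
    by_cases hl : l = k
    · subst hl; simp [hX hk]
    · simp [hl]
  · rw [Finset.mem_insert, Finset.mem_erase, mem_beadFamily_succ hL hne hX,
      mem_beadFamily_succ hL hne hX', or_iff_right (hne k l).symm, Finset.mem_erase, ne_eq,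
      Nat.succ_inj, hL.eq_iff]
    by_cases hl : l = k
    · subst hl; simp [hX hk]
    · simp [hl]
  · rw [Finset.mem_insert, Finset.mem_erase, mem_beadFamily_of_ne hy,
      mem_beadFamily_of_ne hy, or_iff_right (hy k).1.symm, and_iff_right (hy k).2.symm]

theorem beadFamily_insert (hL : Function.Injective L) (hne : ∀ k l, L k ≠ L l + 1)
    (hX : X ⊆ U) {k : ℕ} (hk : k ∈ U) (hkX : k ∉ X) :
    insert (L k + 1) ((beadFamily L B U X).erase (L k)) = beadFamily L B U (insert k X) := by
  have hX' : insert k X ⊆ U := Finset.insert_subset hk hX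
  have h := beadFamily_erase (B := B) hL hne hX' (Finset.mem_insert_self k X)
  rw [Finset.erase_insert hkX] at h
  rw [← h, Finset.erase_insert, Finset.insert_erase]
  · rw [mem_beadFamily_succ hL hne hX', if_pos hk]
    exact Finset.mem_insert_self _ _
  · rw [Finset.mem_erase, mem_beadFamily_self hL hne, if_pos hk]
    simp

theorem beadFamily_card (hL : Function.Injective L) (hne : ∀ k l, L k ≠ L l + 1)
    (hX : X ⊆ U) : (beadFamily L B U X).card = (beadFamily L B U ∅).card := by
  induction X using Finset.induction_on with
  | empty => rfl
  | insert k X hk ih =>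
    have hX' : X ⊆ U := (Finset.subset_insert _ _).trans hX
    have hkU : k ∈ U := hX (Finset.mem_insert_self _ _)
    rw [← ih hX', ← beadFamily_insert hL hne hX' hkU hk, Finset.card_insert_of_notMem,
      Finset.card_erase_add_one]
    · rw [mem_beadFamily_self hL hne, if_pos hkU]
      exact hk
    · rw [Finset.mem_erase, mem_beadFamily_succ hL hne hX', if_pos hkU]
      exact fun h => hk h.2

theorem beadFamily_injOn (hL : Function.Injective L) (hne : ∀ k l, L k ≠ L l + 1)
    (hX : X ⊆ U) (hY : Y ⊆ U) (h : beadFamily L B U X = beadFamily L B U Y) : X = Y := by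
  ext k
  by_cases hk : k ∈ U
  · have h1 := mem_beadFamily_succ (B := B) hL hne hX k
    rw [h, mem_beadFamily_succ hL hne hY, if_pos hk, if_pos hk] at h1
    exact h1.symm
  · exact iff_of_false (fun h => hk (hX h)) fun h => hk (hY h)

end Family

/-! ### Single bead moves between the two runners -/

section Swap

variable {p r i : ℕ} {ε : ZMod p} {L : ℕ → ℕ} {B U : Finset ℕ} {D : Finset ℕ → YoungDiagram}

/-- For `k ∉ U` the positions `L k` and `L k + 1` are both full or both empty, so a bead can move
from `L k + 1` to `L k` exactly when `k ∈ X`. -/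
theorem eFun_beadFamily (hL : Function.Injective L) (hne : ∀ k l, L k ≠ L l + 1)
    (hU : ∀ k, k ∈ U ↔ ¬(L k ∈ B ↔ L k + 1 ∈ B)) (hip : i ≤ p)
    (hLi : ∀ k, L k + 1 = i + k * p) (hε : ε = (i : ZMod p) - (r : ZMod p))
    (hD : ∀ X ⊆ U, IsAbacusDisplay (D X) r (beadFamily L B U X))
    (X : Finset ℕ) (hX : X ⊆ U) :
    eFun p ε (spechtChar (D X)) = ∑ k ∈ X, spechtChar (D (X.erase k)) := by
  classical
  have hsub : ∀ k, X.erase k ⊆ U := fun k => (Finset.erase_subset _ _).trans hX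
  have hset : lower p ε (D X) = X.image fun k => D (X.erase k) := by
    ext nu
    rw [mem_lower_iff (hD X hX) hε, Finset.mem_image]
    constructor
    · rintro ⟨x, hx1, hx, hres, hd⟩
      obtain ⟨k, hk⟩ := (natCast_eq_iff_onRunner hip x).1 hres
      obtain rfl : x = L k := by have := hLi k; omega
      have hkX : k ∈ X := by
        rw [mem_beadFamily_succ hL hne hX] at hx1
        rw [mem_beadFamily_self hL hne] at hx
        by_cases hkU : k ∈ U
        · simpa [hkU] using hx1
        · rw [if_neg hkU] at hx1 hx
          exact absurd ((hU k).2 fun h => hx (h.2 hx1)) hkU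
      rw [beadFamily_erase hL hne hX hkX] at hd
      exact ⟨k, hkX, (hD _ (hsub k)).unique hd⟩
    · rintro ⟨k, hk, rfl⟩
      refine ⟨L k, ?_, ?_, (natCast_eq_iff_onRunner hip _).2 ⟨k, hLi k⟩, ?_⟩
      · rwa [mem_beadFamily_succ hL hne hX, if_pos (hX hk)]
      · rw [mem_beadFamily_self hL hne, if_pos (hX hk)]
        exact fun h => h hk
      · rw [beadFamily_erase hL hne hX hk]
        exact hD _ (hsub k)
  rw [eFun_spechtChar, hset, Finset.sum_image]
  -- The characters do not repeat: a diagram determines its beads, these determine the subset, and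
  -- the subset determines `k`.
  intro k hk l _ h
  by_contra hkl
  have h1 := (hD _ (hsub k)).2.trans ((congrArg (fun la : YoungDiagram =>
    (Finset.range r).image fun j => la.rowLen j + (r - 1 - j)) h).trans (hD _ (hsub l)).2.symm)
  have h2 := beadFamily_injOn hL hne (hsub k) (hsub l) h1
  have h3 : k ∈ X.erase l := Finset.mem_erase.2 ⟨hkl, hk⟩
  rw [← h2] at h3
  exact Finset.notMem_erase _ _ h3

/-- The reverse moves, for `k ∈ U \ X`. The bead at `0` when `i = p` excludes a new row of residue
`ε` that the display would miss. -/
theorem fFun_beadFamily (hL : Function.Injective L) (hne : ∀ k l, L k ≠ L l + 1)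
    (hU : ∀ k, k ∈ U ↔ ¬(L k ∈ B ↔ L k + 1 ∈ B)) (hi : 1 ≤ i) (hip : i ≤ p)
    (hLi : ∀ k, L k + 1 = i + k * p) (hε : ε = (i : ZMod p) - (r : ZMod p))
    (hD : ∀ X ⊆ U, IsAbacusDisplay (D X) r (beadFamily L B U X))
    (hlast : i = p → ∀ X ⊆ U, 0 ∈ beadFamily L B U X) (X : Finset ℕ) (hX : X ⊆ U) :
    fFun p ε (spechtChar (D X)) = ∑ k ∈ U \ X, spechtChar (D (insert k X)) := by
  classical
  have hsub : ∀ k ∈ U, insert k X ⊆ U := fun k hk => Finset.insert_subset hk hX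
  have hset : upper p ε (D X) = (U \ X).image fun k => D (insert k X) := by
    ext mu
    rw [mem_upper_iff (hD X hX) hi hip (fun h => hlast h X hX) hε, Finset.mem_image]
    constructor
    · rintro ⟨x, hx, hx1, hres, hd⟩
      obtain ⟨k, hk⟩ := (natCast_eq_iff_onRunner hip x).1 hres
      obtain rfl : x = L k := by have := hLi k; omega
      have hkX : k ∈ U \ X := by
        rw [mem_beadFamily_succ hL hne hX] at hx1
        rw [mem_beadFamily_self hL hne] at hx
        by_cases hkU : k ∈ U
        · simpa [hkU] using hx
        · rw [if_neg hkU] at hx1 hx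
          exact absurd ((hU k).2 fun h => hx1 (h.1 hx)) hkU
      rw [Finset.mem_sdiff] at hkX
      rw [beadFamily_insert hL hne hX hkX.1 hkX.2] at hd
      exact ⟨k, Finset.mem_sdiff.2 hkX, (hD _ (hsub k hkX.1)).unique hd⟩
    · rintro ⟨k, hk, rfl⟩
      rw [Finset.mem_sdiff] at hk
      refine ⟨L k, ?_, ?_, (natCast_eq_iff_onRunner hip _).2 ⟨k, hLi k⟩, ?_⟩
      · rw [mem_beadFamily_self hL hne, if_pos hk.1]
        exact hk.2
      · rw [mem_beadFamily_succ hL hne hX, if_pos hk.1]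
        exact hk.2
      · rw [beadFamily_insert hL hne hX hk.1 hk.2]
        exact hD _ (hsub k hk.1)
  rw [fFun_spechtChar, hset, Finset.sum_image]
  intro k hk l hl h
  rw [Finset.mem_coe, Finset.mem_sdiff] at hk hl
  have h1 := (hD _ (hsub k hk.1)).2.trans ((congrArg (fun la : YoungDiagram =>
    (Finset.range r).image fun j => la.rowLen j + (r - 1 - j)) h).trans (hD _ (hsub l hl.1)).2.symm)
  have h2 := beadFamily_injOn hL hne (hsub k hk.1) (hsub l hl.1) h1
  have h3 : k ∈ insert k X := Finset.mem_insert_self _ _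
  rw [h2, Finset.mem_insert] at h3
  exact h3.resolve_right hk.2

open Classical in
/-- The permutation of the positions that swaps runners `i - 1` and `i`. -/
def swapPos (p i x : ℕ) : ℕ :=
  if OnRunner p (i - 1) x then x + 1 else if OnRunner p i x then x - 1 else x

theorem swapPos_runner (hLi : ∀ k, L k + 1 = i + k * p) (hi : 1 ≤ i) (k : ℕ) :
    swapPos p i (L k) = L k + 1 := by
  refine if_pos ⟨k, ?_⟩
  have := hLi k
  omega

theorem swapPos_runner_succ (hne : ∀ k l, L k ≠ L l + 1) (hLi : ∀ k, L k + 1 = i + k * p)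
    (hi : 1 ≤ i) (k : ℕ) : swapPos p i (L k + 1) = L k := by
  rw [swapPos, if_neg, if_pos ⟨k, hLi k⟩, Nat.add_sub_cancel]
  rintro ⟨l, hl⟩
  refine hne l k ?_
  have := hLi l
  omega

theorem swapPos_of_ne (hLi : ∀ k, L k + 1 = i + k * p) (hi : 1 ≤ i) {y : ℕ}
    (hy : ∀ k, L k ≠ y ∧ L k + 1 ≠ y) : swapPos p i y = y := by
  rw [swapPos, if_neg, if_neg]
  · rintro ⟨l, hl⟩
    refine (hy l).2 ?_
    have := hLi l
    omega
  · rintro ⟨l, hl⟩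
    refine (hy l).1 ?_
    have := hLi l
    omega

theorem mem_swapRunners (hne : ∀ k l, L k ≠ L l + 1) (hLi : ∀ k, L k + 1 = i + k * p)
    (hi : 1 ≤ i) (B : Finset ℕ) (y : ℕ) : y ∈ swapRunners p i B ↔ swapPos p i y ∈ B := by
  have hinv : ∀ x, swapPos p i (swapPos p i x) = x := by
    intro x
    by_cases hx : ∀ k, L k ≠ x ∧ L k + 1 ≠ x
    · rw [swapPos_of_ne hLi hi hx, swapPos_of_ne hLi hi hx]
    · push Not at hx
      obtain ⟨k, hk⟩ := hx
      by_cases h : L k = x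
      · rw [← h, swapPos_runner hLi hi, swapPos_runner_succ hne hLi hi]
      · rw [← hk h, swapPos_runner_succ hne hLi hi, swapPos_runner hLi hi]
  change y ∈ B.image (swapPos p i) ↔ _
  rw [Finset.mem_image]
  constructor
  · rintro ⟨x, hx, rfl⟩
    rwa [hinv]
  · exact fun h => ⟨_, h, hinv y⟩

theorem beadCount_eq_card_preimage {M : ℕ → ℕ} (hM : Function.Injective M) {j : ℕ}
    (hMj : ∀ k, M k = j + k * p) (B : Finset ℕ) :
    beadCount p B j = (B.preimage M hM.injOn).card := by
  classical
  rw [beadCount, ← Finset.card_image_of_injective (B.preimage M hM.injOn) hM]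
  refine congrArg Finset.card ?_
  ext x
  simp only [Finset.mem_filter, Finset.mem_image, Finset.mem_preimage]
  constructor
  · rintro ⟨hx, k, hk⟩
    exact ⟨k, by rwa [hMj, ← hk], by rw [hMj, hk]⟩
  · rintro ⟨k, hk, rfl⟩
    exact ⟨hk, k, hMj k⟩

theorem eq_or_eq_neg_of_sign_smul {m : ℕ} {χ ψ : ClassFun} (h : χ = (-1 : ℚ) ^ m • ψ) :
    χ = ψ ∨ χ = -ψ := by
  rcases neg_one_pow_eq_or ℚ m with hm | hm
  · left; rw [h, hm, one_smul]
  · right; rw [h, hm, neg_one_smul]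

end Swap
end RunnerSwap

end

/-! ### The runner swap theorem -/

open RunnerSwap in
theorem mainTheorem4 (p : ℕ) (hp : p.Prime) (hodd : Odd p)
    (la : YoungDiagram) (r : ℕ) (B : Finset ℕ) (hB : RunnerSwap.IsAbacusDisplay la r B)
    (i : ℕ) (hi : 1 ≤ i) (hip : i ≤ p) (hlast : i = p → la.colLen 0 < r)
    (a : ℤ) (ha : a = (RunnerSwap.beadCount p B (i - 1) : ℤ) - (RunnerSwap.beadCount p B i : ℤ))
    (ε : ZMod p) (hε : ε = (i : ZMod p) - (r : ZMod p)) :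
    (∃! mu : YoungDiagram, RunnerSwap.IsAbacusDisplay mu r (RunnerSwap.swapRunners p i B)) ∧
    ∀ mu : YoungDiagram, RunnerSwap.IsAbacusDisplay mu r (RunnerSwap.swapRunners p i B) →
      (RunnerSwap.runnerSwap p ε a (RunnerSwap.spechtChar la) = RunnerSwap.spechtChar mu ∨
        RunnerSwap.runnerSwap p ε a (RunnerSwap.spechtChar la) = -RunnerSwap.spechtChar mu) ∧
      (RunnerSwap.runnerSwap p ε (-a) (RunnerSwap.spechtChar mu) = RunnerSwap.spechtChar la ∨
        RunnerSwap.runnerSwap p ε (-a) (RunnerSwap.spechtChar mu) = -RunnerSwap.spechtChar la) := by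
  have hp2 := hp.two_le
  let L : ℕ → ℕ := fun k => i - 1 + k * p
  have hLi : ∀ k, L k + 1 = i + k * p := fun k => by simp only [L]; omega
  have hL : Function.Injective L := fun k l h => by
    have : k * p = l * p := Nat.add_left_cancel h
    exact Nat.eq_of_mul_eq_mul_right hp.pos this
  -- The two runners are disjoint, since otherwise `p` would divide `1`.
  have hne : ∀ k l, L k ≠ L l + 1 := fun k l h => by
    have h1 : k * p = l * p + 1 := by simp only [L] at h; omega
    have h2 : p ∣ 1 := (Nat.dvd_add_right (Dvd.intro_left l rfl)).1 (h1 ▸ Dvd.intro_left k rfl)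
    have := Nat.le_of_dvd one_pos h2
    omega
  have hL1 : Function.Injective fun k => L k + 1 := fun k l h => hL (Nat.succ_injective h)
  let lo := B.preimage L hL.injOn
  let up := B.preimage (fun k => L k + 1) hL1.injOn
  have hlo : ∀ k, k ∈ lo ↔ L k ∈ B := fun k => Finset.mem_preimage
  have hhi : ∀ k, k ∈ up ↔ L k + 1 ∈ B := fun k => Finset.mem_preimage
  let U := lo \ up ∪ up \ lo
  have hU : ∀ k, k ∈ U ↔ ¬(L k ∈ B ↔ L k + 1 ∈ B) := fun k => by
    simp only [U, Finset.mem_union, Finset.mem_sdiff, hlo, hhi]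
    tauto
  have hR : up \ lo ⊆ U := Finset.subset_union_right
  have hA : lo \ up ⊆ U := Finset.subset_union_left
  have hUR : U \ (up \ lo) = lo \ up := by
    ext k
    simp only [U, Finset.mem_union, Finset.mem_sdiff]
    tauto
  have hUA : U \ (lo \ up) = up \ lo := by
    ext k
    simp only [U, Finset.mem_union, Finset.mem_sdiff]
    tauto
  -- The display of `la` is the member for `up \ lo`, the rows with a bead on runner `i` only; its
  -- swap is the member for the complement `lo \ up`.
  have hBR : beadFamily L B U (up \ lo) = B := by
    refine ext_runners (L := L) (fun k => ?_) (fun k => ?_) fun y hy => mem_beadFamily_of_ne hy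
    · rw [mem_beadFamily_self hL hne, Finset.mem_sdiff, hlo, hhi]
      have := hU k
      split_ifs <;> tauto
    · rw [mem_beadFamily_succ hL hne hR, Finset.mem_sdiff, hlo, hhi]
      have := hU k
      split_ifs <;> tauto
  have hBA : beadFamily L B U (lo \ up) = swapRunners p i B := by
    refine ext_runners (L := L) (fun k => ?_) (fun k => ?_) fun y hy => ?_
    · rw [mem_swapRunners hne hLi hi, swapPos_runner hLi hi, mem_beadFamily_self hL hne,
        Finset.mem_sdiff, hlo, hhi]
      have := hU k
      split_ifs <;> tauto
    · rw [mem_swapRunners hne hLi hi, swapPos_runner_succ hne hLi hi,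
        mem_beadFamily_succ hL hne hA, Finset.mem_sdiff, hlo, hhi]
      have := hU k
      split_ifs <;> tauto
    · rw [mem_swapRunners hne hLi hi, swapPos_of_ne hLi hi hy, mem_beadFamily_of_ne hy]
  have hcard : ∀ X ⊆ U, (beadFamily L B U X).card = r := fun X hX => by
    rw [beadFamily_card hL hne hX, ← beadFamily_card hL hne hR, hBR, hB.card]
  -- The condition `X ⊆ U` stands inside the existential so that `D` is defined on all finite sets.
  have hex : ∀ X : Finset ℕ, ∃ nu, X ⊆ U → IsAbacusDisplay nu r (beadFamily L B U X) := fun X => by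
    obtain ⟨nu, hnu⟩ := exists_isAbacusDisplay (beadFamily L B U X)
    exact ⟨nu, fun hX => hcard X hX ▸ hnu⟩
  choose D hD using hex
  -- For `i = p` the first position in play is `p - 1 > 0`, so the bead at `0` never moves.
  have hzero : i = p → ∀ X ⊆ U, 0 ∈ beadFamily L B U X := fun hip X _ => by
    rw [mem_beadFamily_of_ne, hB.zero_mem_iff]
    · exact hlast hip
    · intro k
      have := hLi k
      omega
  have he := eFun_beadFamily hL hne hU hip hLi hε hD
  have hf := fFun_beadFamily hL hne hU hi hip hLi hε hD hzero
  have hDR : D (up \ lo) = la := (hBR ▸ hD _ hR).unique hB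
  have hDA := hD _ hA
  rw [hBA] at hDA
  -- Rows with a bead on both runners cancel in the difference of the bead counts.
  have hcount : a = ((lo \ up).card : ℤ) - ((up \ lo).card : ℤ) := by
    rw [ha, beadCount_eq_card_preimage hL (fun k => rfl), beadCount_eq_card_preimage hL1 hLi]
    have h1 := Finset.card_sdiff_add_card_inter lo up
    have h2 := Finset.card_sdiff_add_card_inter up lo
    rw [Finset.inter_comm] at h2
    change (lo.card : ℤ) - (up.card : ℤ) = _
    omega
  refine ⟨⟨_, hDA, fun nu hnu => hnu.unique hDA⟩, fun mu hmu => ?_⟩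
  obtain rfl := hmu.unique hDA
  constructor
  · have h := runnerSwap_boolean (v := fun X => spechtChar (D X)) he hf hR (c := a)
      (by rw [hUR, hcount])
    simp only [hUR, hDR] at h
    exact eq_or_eq_neg_of_sign_smul h
  · have h := runnerSwap_boolean (v := fun X => spechtChar (D X)) he hf hA (c := -a)
      (by rw [hUA, hcount]; ring)
    simp only [hUA, hDR] at h
    exact eq_or_eq_neg_of_sign_smul h
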